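/- Write $\overline{\mathbb D}=\{z\in\mathbb C:|z|\le 1\}$. For a reproducing kernel Hilbert space $\mathcal H$ of complex-valued functions on a set $X$ with kernel $k$, let $\mathrm{Mult}(\mathcal H)$ be the algebra of all $\varphi:X\to\mathbb C$ with $\varphi f\in\mathcal H$ for every $f\in\mathcal H$, with the norm $\|\varphi\|=\|M_\varphi\|$ of the multiplication operator $M_\varphi f=\varphi f$ on $\mathcal H$; the norm of a matrix in $M_r(\mathrm{Mult}(\mathcal H))$ is that of the corresponding multiplication operator on $\mathcal H^r$. - $\mathcal H$ is a complete Pick space if for all $r,n\in\mathbb N$, $z_1,\dots,z_n\in X$ and $W_1,\dots,W_n\in M_r(\mathbb C)$, positive semidefiniteness of the block matrix $[k(z_i,z_j)(I-W_iW_j^*)]_{i,j=1}^n$ implies that there is $\Phi\in M_r(\mathrm{Mult}(\mathcal H))$ of norm at most $1$ with $\Phi(z_i)=W_i$ for all $i$. - $X$ is a maximal domain for $\mathcal H$ if every non-zero bounded linear functional $\rho$ on $\mathcal H$ such that $\rho(fg)=\rho(f)\rho(g)$ whenever $f,g,fg\in\mathcal H$ is evaluation at a point of $X$. - The one-function corona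 theorem holds for $\mathrm{Mult}(\mathcal H)$ if $1/\varphi\in\mathrm{Mult}(\mathcal H)$ for every $\varphi\in\mathrm{Mult}(\mathcal H)$ with $\inf_{x\in X}|\varphi(x)|>0$. **Theorem.** There exists a complete Pick space $\mathcal H$ on $\overline{\mathbb D}$ with reproducing kernel of the form $$k(z,w)=\sum_{n=0}^\infty a_n(z\overline w)^n\qquad(z,w\in\overline{\mathbb D}),$$ where $a_0=1$, $a_n>0$ for all $n$, $\lim_{n\to\infty}a_n/a_{n+1}=1$ and $\sum_n a_n<\infty$, such that $\overline{\mathbb D}$ is a maximal domain for $\mathcal H$ and the one-function corona theorem for $\mathrm{Mult}(\mathcal H)$ fails. In particular, $\overline{\mathbb D}$ is a proper compact subset of the maximal ideal space of $\mathrm{Mult}(\mathcal H)$: sending $z$ to evaluation at $z$ is a homeomorphism of $\overline{\mathbb D}$ onto a compact proper subset of the space of characters of $\mathrm{Mult}(\mathcal H)$ with the Gelfand topology. -/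

import Mathlib

/-- The closed unit disc in the complex plane. -/
abbrev ClosedDisc : Type := Metric.closedBall (0 : ℂ) 1

noncomputable section MultiplierAlgebra

variable {X : Type*} (H : Type*) [NormedAddCommGroup H] [InnerProductSpace ℂ H]
  [RKHS ℂ H X ℂ]

/-- The scalar kernel `k(z, w) = ⟨k_w, k_z⟩` of a Hilbert space `H` of complex-valued functions
on `X`, so that `k(·, w)` is the element of `H` that represents evaluation at `w`. -/
def scalarKernel [CompleteSpace H] (z w : X) : ℂ := RKHS.kernel H z w 1

/-- All functions `φ : X → ℂ` with `φ f ∈ H` for every `f ∈ H`, as an algebra of functions. -/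
def multiplierSubalgebra : Subalgebra ℂ (X → ℂ) where
  carrier := {φ | ∀ f : H, ∃ g : H, ∀ x, g x = φ x * f x}
  mul_mem' := by
    intro φ ψ hφ hψ f
    obtain ⟨g, hg⟩ := hψ f
    obtain ⟨h, hh⟩ := hφ g
    exact ⟨h, fun x => by simp [hh, hg, mul_assoc]⟩
  add_mem' := by
    intro φ ψ hφ hψ f
    obtain ⟨g, hg⟩ := hφ f
    obtain ⟨h, hh⟩ := hψ f
    exact ⟨g + h, fun x => by simp [hh, hg, add_mul]⟩
  algebraMap_mem' := fun c f => ⟨c • f, fun x => by simp⟩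

/-- The multiplier algebra of `H`. It is a type of its own because it carries the norm
`‖φ‖ = ‖M_φ‖` and not the topology of pointwise convergence on `X`. -/
def Mult : Type _ := multiplierSubalgebra H

namespace Mult

instance instCommRing : CommRing (Mult H) :=
  inferInstanceAs (CommRing (multiplierSubalgebra H))

instance instAlgebra : Algebra ℂ (Mult H) :=
  inferInstanceAs (Algebra ℂ (multiplierSubalgebra H))

instance instCoeFun : CoeFun (Mult H) (fun _ => X → ℂ) := ⟨fun φ => φ.1⟩

variable {H}

theorem exists_mul (φ : Mult H) (f : H) : ∃ g : H, ∀ x, g x = φ x * f x := φ.2 f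

/-- The product `φ f` of a multiplier and an element of `H`, as an element of `H`. -/
def mulFun (φ : Mult H) (f : H) : H := (φ.exists_mul f).choose

theorem mulFun_apply (φ : Mult H) (f : H) (x : X) : φ.mulFun f x = φ x * f x :=
  (φ.exists_mul f).choose_spec x

/-- Multiplication by `φ` as a linear map. -/
def mulLin (φ : Mult H) : H →ₗ[ℂ] H where
  toFun := φ.mulFun
  map_add' f g := RKHS.ext fun x => by simp [mulFun_apply, mul_add]
  map_smul' c f := RKHS.ext fun x => by simp [mulFun_apply, mul_left_comm]

variable [CompleteSpace H]

/-- The multiplication operator `M_φ`, bounded by the closed graph theorem. -/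
def mulOp (φ : Mult H) : H →L[ℂ] H :=
  ContinuousLinearMap.ofSeqClosedGraph (g := φ.mulLin) (by
    intro u f g hu hv
    refine RKHS.ext fun x => ?_
    have h1 := ((RKHS.continuous_eval (H := H) x).tendsto g).comp hv
    have h2 := (((RKHS.continuous_eval (H := H) x).tendsto f).comp hu).const_mul (φ x)
    refine tendsto_nhds_unique h1 ?_
    have : φ.mulLin f x = φ x * f x := φ.mulFun_apply f x
    rw [this]
    refine h2.congr fun n => ?_
    exact (φ.mulFun_apply (u n) x).symm)

theorem mulOp_apply (φ : Mult H) (f : H) (x : X) : φ.mulOp f x = φ x * f x :=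
  φ.mulFun_apply f x

variable (H) in
/-- The representation `φ ↦ M_φ` of the multiplier algebra on `H`. -/
def mulHom : Mult H →+* (H →L[ℂ] H) where
  toFun := mulOp
  map_one' := by
    ext f x
    rw [mulOp_apply]
    exact one_mul (f x)
  map_mul' φ ψ := by
    ext f x
    change (φ * ψ).mulOp f x = φ.mulOp (ψ.mulOp f) x
    rw [mulOp_apply, mulOp_apply, mulOp_apply]
    exact mul_assoc (φ x) (ψ x) (f x)
  map_zero' := by
    ext f x
    rw [mulOp_apply, _root_.zero_apply, RKHS.coe_zero]
    exact zero_mul (f x)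
  map_add' φ ψ := by
    ext f x
    rw [mulOp_apply, _root_.add_apply, RKHS.coe_add, Pi.add_apply, mulOp_apply,
      mulOp_apply]
    exact add_mul (φ x) (ψ x) (f x)

/-- The multiplier norm `‖φ‖ = ‖M_φ‖`. (It is a norm as soon as the kernel does not vanish on
the diagonal.) -/
instance instSeminormedCommRing : SeminormedCommRing (Mult H) :=
  { SeminormedRing.induced (Mult H) (H →L[ℂ] H) (mulHom H) with
    mul_comm := mul_comm }

theorem norm_def (φ : Mult H) : ‖φ‖ = ‖φ.mulOp‖ := rfl

/-- The operator on `H^r` (Hilbert space direct sum) of multiplication by an `r × r` matrix of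
multipliers; its operator norm is the norm of `M_r(Mult(H))`. -/
def matrixOp {r : ℕ} (Φ : Matrix (Fin r) (Fin r) (Mult H)) :
    PiLp 2 (fun _ : Fin r => H) →L[ℂ] PiLp 2 (fun _ : Fin r => H) :=
  (PiLp.continuousLinearEquiv 2 ℂ (fun _ : Fin r => H)).symm.toContinuousLinearMap ∘L
    ContinuousLinearMap.pi fun i => ∑ j, (Φ i j).mulOp ∘L PiLp.proj 2 (fun _ : Fin r => H) j

theorem matrixOp_apply {r : ℕ} (Φ : Matrix (Fin r) (Fin r) (Mult H))
    (f : PiLp 2 (fun _ : Fin r => H)) (i : Fin r) :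
    matrixOp Φ f i = ∑ j, (Φ i j).mulOp (f j) := by
  simp [matrixOp]

end Mult

variable [CompleteSpace H]

open scoped ComplexOrder in
/-- The complete Pick property: positivity of the block matrix
`[k(z_i, z_j) (I - W_i W_j^*)]` implies that the interpolation problem `Φ(z_i) = W_i`
has a solution in the closed unit ball of `M_r(Mult(H))`. -/
def IsCompletePick : Prop :=
  ∀ (r n : ℕ) (z : Fin n → X) (W : Fin n → Matrix (Fin r) (Fin r) ℂ),
    (Matrix.of fun (s t : Fin n × Fin r) =>
      scalarKernel H (z s.1) (z t.1) *
        ((1 : Matrix (Fin r) (Fin r) ℂ) - W s.1 * (W t.1).conjTranspose) s.2 t.2).PosSemidef →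
    ∃ Φ : Matrix (Fin r) (Fin r) (Mult H),
      ‖Mult.matrixOp Φ‖ ≤ 1 ∧ ∀ i p q, (Φ p q) (z i) = W i p q

variable {H} in
/-- A non-zero bounded functional with `ρ(f g) = ρ(f) ρ(g)` whenever `f`, `g` and the pointwise
product `f g` belong to `H`. -/
def IsPartiallyMultiplicative (ρ : StrongDual ℂ H) : Prop :=
  ρ ≠ 0 ∧ ∀ f g h : H, (∀ x, h x = f x * g x) → ρ h = ρ f * ρ g

/-- `X` is a maximal domain for `H`: every partially multiplicative functional is evaluation
at a point of `X`. -/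
def IsMaximalDomain : Prop :=
  ∀ ρ : StrongDual ℂ H, IsPartiallyMultiplicative ρ → ∃ x : X, ∀ f : H, ρ f = f x

/-- The one-function corona theorem for `Mult(H)`: a multiplier that is bounded below on `X`
is invertible in `Mult(H)`. -/
def OneFunctionCorona : Prop :=
  ∀ φ : Mult H, 0 < ⨅ x : X, ‖φ x‖ → ∃ ψ : Mult H, ∀ x, ψ x = 1 / φ x

/-- The maximal ideal space of `Mult(H)`: the characters of this algebra with the Gelfand
topology. -/
abbrev MaximalIdealSpace : Type _ := WeakDual.characterSpace ℂ (Mult H)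

end MultiplierAlgebra

/-!
Choose fast growing blocks `[N_j, N_{j+1})` and mix geometric sequences, `a_k ∝ ∑_j c_j ρ_j^{2k}`
with `ρ_j ↑ 1`, so that `a_k` is comparable to `c_j ρ_j^{2k}` on a long initial part of the `j`-th
block. A mixture of geometric sequences is log-convex, hence by Kaluza's lemma `1 - 1 / k` is
again a positive kernel and the space is a complete Pick space. Since `a_n / a_{n+1} → 1`,
multiplication by `z` is bounded; a partially multiplicative functional is therefore determined by
its value at the function `z`, which has to be a point of the closed disc.

Let `g = ∑_j n_j⁻¹ ∑_{n_j ≤ m < 2 n_j} ρ_j^m z^m`, with sup norm at most `1 / 3`. In the orthonormal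
basis of normalized monomials the part of `M_g` with `k` below the block of the window of `m` is
Hilbert–Schmidt and the rest passes Schur's test, because the middle parts belonging to different
windows share neither rows nor columns; hence `g` is a multiplier. On the `j`-th block, however,
multiplication by `g` averages the sequence `ρ_j^k` over a window, so it almost preserves it: if
`(1 - g) ψ = 1` and `E` is `∑ ρ_j^k z^k` over the first `2 n_j` indices of the block, then the
coefficients of `ψ E` dominate `ρ_j^k` on the first `(j + 1) n_j` indices, and comparing norms gives
`j + 1 ≤ 6 ‖ψ‖²` for every `j`. So `1 - g` is bounded below without being invertible, and some
character vanishes at it.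
-/

section Gram

open scoped ComplexOrder

variable {ι E F : Type*} [NormedAddCommGroup E] [InnerProductSpace ℂ E]
  [NormedAddCommGroup F] [InnerProductSpace ℂ F] {x : ι → E} {y : ι → F}

theorem sum_star_mul_gram_mul (x : ι → E) (c : ι →₀ ℂ) :
    (c.sum fun i ci => c.sum fun j cj => star ci * Matrix.gram ℂ x i j * cj) =
      (‖Finsupp.linearCombination ℂ x c‖ : ℂ) ^ 2 := by
  rw [← Complex.coe_algebraMap, ← inner_self_eq_norm_sq_to_K, Finsupp.linearCombination_apply]
  simp only [Finsupp.sum, sum_inner, inner_sum, inner_smul_left, inner_smul_right,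
    Matrix.gram_apply, starRingEnd_apply, Finset.mul_sum]
  rw [Finset.sum_comm]
  exact Finset.sum_congr rfl fun i _ => Finset.sum_congr rfl fun j _ => by ring

theorem posSemidef_gram_sub_gram_iff :
    (Matrix.gram ℂ x - Matrix.gram ℂ y).PosSemidef ↔
      ∀ c, ‖Finsupp.linearCombination ℂ y c‖ ≤ ‖Finsupp.linearCombination ℂ x c‖ := by
  have hsum (c : ι →₀ ℂ) :
      (c.sum fun i ci => c.sum fun j cj =>
        star ci * (Matrix.gram ℂ x - Matrix.gram ℂ y) i j * cj) =
      (‖Finsupp.linearCombination ℂ x c‖ ^ 2 - ‖Finsupp.linearCombination ℂ y c‖ ^ 2 : ℝ) := by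
    push_cast
    rw [← sum_star_mul_gram_mul, ← sum_star_mul_gram_mul]
    simp only [Matrix.sub_apply, mul_sub, sub_mul, Finsupp.sum_sub]
  have hHerm := (Matrix.isHermitian_gram ℂ x).sub (Matrix.isHermitian_gram ℂ y)
  simp only [Matrix.PosSemidef, hHerm, true_and, hsum, Complex.zero_le_real, sub_nonneg]
  exact forall_congr' fun c => sq_le_sq₀ (norm_nonneg _) (norm_nonneg _)

theorem posSemidef_gram (x : ι → E) : (Matrix.gram ℂ x).PosSemidef := by
  have h := (posSemidef_gram_sub_gram_iff (x := x) (y := (0 : ι → E))).2 fun c => by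
    simp [Finsupp.linearCombination_apply]
  rwa [Matrix.gram_zero, sub_zero] at h

theorem posSemidef_gram_sub_gram_map (x : ι → E) {V : E →L[ℂ] F} (hV : ‖V‖ ≤ 1) :
    (Matrix.gram ℂ x - Matrix.gram ℂ (V ∘ x)).PosSemidef :=
  posSemidef_gram_sub_gram_iff.2 fun c => by
    have hVc : Finsupp.linearCombination ℂ (V ∘ x) c = V (Finsupp.linearCombination ℂ x c) :=
      (Finsupp.apply_linearCombination ℂ V.toLinearMap x c).symm
    simpa only [hVc, one_mul] using V.le_of_opNorm_le hV (Finsupp.linearCombination ℂ x c)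

theorem exists_gram_eq [Fintype ι] {P : Matrix ι ι ℂ} (hP : P.PosSemidef) :
    ∃ l : ι → EuclideanSpace ℂ ι, Matrix.gram ℂ l = P := by
  classical
  open scoped MatrixOrder in
  obtain ⟨B, rfl⟩ := CStarAlgebra.nonneg_iff_eq_star_mul_self.1 hP.nonneg
  refine ⟨fun i => WithLp.toLp 2 fun k => B k i, Matrix.ext fun i j => ?_⟩
  simp [PiLp.inner_apply, Matrix.mul_apply, Matrix.star_apply, mul_comm]

/-- Douglas' lemma. -/
theorem exists_contraction_of_posSemidef [CompleteSpace F]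
    (h : (Matrix.gram ℂ x - Matrix.gram ℂ y).PosSemidef) :
    ∃ V : E →L[ℂ] F, ‖V‖ ≤ 1 ∧ ∀ i, V (x i) = y i := by
  let J : E →ₗᵢ[ℂ] UniformSpace.Completion E := UniformSpace.Completion.toComplₗᵢ
  let Lx := J.toLinearMap ∘ₗ Finsupp.linearCombination ℂ x
  let Ly := Finsupp.linearCombination ℂ y
  let S := Lx.range.topologicalClosure
  let e : (ι →₀ ℂ) →ₗ[ℂ] S := Lx.codRestrict S fun c =>
    Submodule.le_topologicalClosure _ (LinearMap.mem_range_self Lx c)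
  have hdense : DenseRange e := by
    refine (Topology.IsInducing.subtypeVal.dense_iff).2 fun t => ?_
    rw [← Set.range_comp]
    exact t.2
  have hle (c) : ‖Ly c‖ ≤ 1 * ‖e c‖ := by
    simpa [e, Lx] using posSemidef_gram_sub_gram_iff.1 h c
  have : CompleteSpace S := (Submodule.isClosed_topologicalClosure _).completeSpace_coe
  refine ⟨Ly.extendOfNorm e ∘L S.orthogonalProjectionOnto ∘L J.toContinuousLinearMap, ?_,
    fun i => ?_⟩
  · refine ContinuousLinearMap.opNorm_le_bound _ zero_le_one fun v => ?_
    calc ‖Ly.extendOfNorm e (S.orthogonalProjectionOnto (J v))‖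
        ≤ 1 * ‖S.orthogonalProjectionOnto (J v)‖ :=
          LinearMap.norm_extendOfNorm_apply_le hdense 1 hle _
      _ ≤ 1 * ‖v‖ := by
          grw [S.norm_orthogonalProjectionOnto_apply_le, J.norm_map]
  · have hei : S.orthogonalProjectionOnto (J (x i)) = e (Finsupp.single i 1) := by
      rw [← Submodule.orthogonalProjectionOnto_mem_subspace_eq_self (e (Finsupp.single i 1))]
      simp [e, Lx]
    change Ly.extendOfNorm e (S.orthogonalProjectionOnto (J (x i))) = y i
    rw [hei, LinearMap.extendOfNorm_eq hdense ⟨1, hle⟩]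
    simp [Ly]

end Gram

section Pick

open scoped ComplexOrder TensorProduct

variable {K E F G H : Type*} [NormedAddCommGroup K] [InnerProductSpace ℂ K]
  [NormedAddCommGroup E] [InnerProductSpace ℂ E] [NormedAddCommGroup F] [InnerProductSpace ℂ F]
  [NormedAddCommGroup G] [InnerProductSpace ℂ G] [NormedAddCommGroup H] [InnerProductSpace ℂ H]

theorem existsUnique_fst_apply_tmul_eq [CompleteSpace K]
    {V : WithLp 2 (K ⊗[ℂ] E × F) →L[ℂ] WithLp 2 (K × G)} (hV : ‖V‖ ≤ 1) {u : E} (hu : ‖u‖ < 1)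
    (v : F) : ∃! l : K, (V (WithLp.toLp 2 (l ⊗ₜ u, v))).fst = l := by
  have hcontr : ContractingWith ‖u‖₊ fun l : K => (V (WithLp.toLp 2 (l ⊗ₜ u, v))).fst := by
    refine ⟨hu, LipschitzWith.of_dist_le_mul fun l m => ?_⟩
    calc dist (V (WithLp.toLp 2 (l ⊗ₜ u, v))).fst (V (WithLp.toLp 2 (m ⊗ₜ u, v))).fst
        = ‖(V (WithLp.toLp 2 ((l - m) ⊗ₜ u, 0))).fst‖ := by
          rw [dist_eq_norm, ← WithLp.sub_fst, ← map_sub, ← WithLp.toLp_sub, Prod.mk_sub_mk,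
            sub_self, TensorProduct.sub_tmul]
      _ ≤ ‖V (WithLp.toLp 2 ((l - m) ⊗ₜ u, 0))‖ := WithLp.norm_fst_le _ _
      _ ≤ 1 * ‖(l - m) ⊗ₜ[ℂ] u‖ := V.le_of_opNorm_le_of_le hV (by rw [WithLp.norm_toLp_fst])
      _ = ‖u‖₊ * dist l m := by
          rw [one_mul, TensorProduct.norm_tmul, dist_eq_norm, coe_nnnorm, mul_comm]
  exact ⟨_, hcontr.fixedPoint_isFixedPt, fun _ h => hcontr.fixedPoint_unique h⟩

theorem norm_lt_one_of_inner_mul_one_sub_inner_eq_one {k : H} {b : E}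
    (h : inner ℂ k k * (1 - inner ℂ b b) = 1) : ‖b‖ < 1 := by
  have hre : ‖k‖ ^ 2 * (1 - ‖b‖ ^ 2) = 1 := by
    rw [inner_self_eq_norm_sq_to_K, inner_self_eq_norm_sq_to_K] at h
    exact Complex.ofReal_inj.1 (by simpa using h)
  have : 0 < 1 - ‖b‖ ^ 2 := pos_of_mul_pos_right (hre ▸ one_pos) (sq_nonneg _)
  exact (sq_lt_one_iff₀ (norm_nonneg b)).1 (by linarith)

section TensorGram

variable {ι : Type*} {k : ι → H} {b : ι → E} {m : ι → K} {d : ι → F} {v : ι → G}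

theorem gram_tmul_prod_eq
    (hkb : ∀ s t, inner ℂ (k s) (k t) * (1 - inner ℂ (b s) (b t)) = 1)
    (hm : ∀ s t, inner ℂ (m s) (m t) =
      inner ℂ (k s) (k t) * (inner ℂ (d s) (d t) - inner ℂ (v s) (v t))) :
    Matrix.gram ℂ (fun s => WithLp.toLp 2 (m s ⊗ₜ[ℂ] b s, d s)) =
      Matrix.gram ℂ fun s => WithLp.toLp 2 (m s, v s) := by
  ext s t
  simp only [Matrix.gram_apply, WithLp.prod_inner_apply, TensorProduct.inner_tmul, hm]
  linear_combination (inner ℂ (v s) (v t) - inner ℂ (d s) (d t)) * hkb s t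

theorem posSemidef_kernel_mul_sub
    (hkb : ∀ s t, inner ℂ (k s) (k t) * (1 - inner ℂ (b s) (b t)) = 1)
    (h : (Matrix.gram ℂ (fun s => WithLp.toLp 2 (m s ⊗ₜ[ℂ] b s, d s)) -
      Matrix.gram ℂ fun s => WithLp.toLp 2 (m s, v s)).PosSemidef) :
    (Matrix.of fun s t =>
      inner ℂ (k s) (k t) * (inner ℂ (d s) (d t) - inner ℂ (v s) (v t))).PosSemidef := by
  convert! ((posSemidef_gram k).hadamard h).add (posSemidef_gram m) using 1
  ext s t
  simp only [Matrix.of_apply, Matrix.add_apply, Matrix.hadamard_apply, Matrix.sub_apply,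
    Matrix.gram_apply, WithLp.prod_inner_apply, TensorProduct.inner_tmul]
  linear_combination (inner ℂ (m s) (m t)) * hkb s t

end TensorGram

variable {X : Type*} [RKHS ℂ H X ℂ] [CompleteSpace H] {r : ℕ}

theorem scalarKernel_eq_inner (z w : X) :
    scalarKernel H z w = inner ℂ (RKHS.kerFun H z 1) (RKHS.kerFun H w 1) := by
  rw [RKHS.kerFun_inner, RKHS.kerFun_apply, scalarKernel]
  simp

variable (H) in
/-- The vector `k_z ⊗ v` of the direct sum `H^r = H ⊗ ℂ^r`. -/
noncomputable def vectorKernel (z : X) (v : EuclideanSpace ℂ (Fin r)) :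
    PiLp 2 (fun _ : Fin r => H) :=
  WithLp.toLp 2 fun p => v p • RKHS.kerFun H z 1

theorem vectorKernel_inner (z : X) (v : EuclideanSpace ℂ (Fin r))
    (f : PiLp 2 (fun _ : Fin r => H)) :
    inner ℂ (vectorKernel H z v) f = ∑ p, star (v p) * f p z := by
  simp [vectorKernel, PiLp.inner_apply, inner_smul_left]

theorem inner_vectorKernel (z w : X) (u v : EuclideanSpace ℂ (Fin r)) :
    inner ℂ (vectorKernel H z u) (vectorKernel H w v) = scalarKernel H z w * inner ℂ u v := by
  rw [vectorKernel_inner, PiLp.inner_apply, Finset.mul_sum]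
  refine Finset.sum_congr rfl fun p _ => ?_
  simp [vectorKernel, RKHS.kerFun_apply, scalarKernel]
  ring

theorem Mult.exists_matrixOp_eq {T : PiLp 2 (fun _ : Fin r => H) →L[ℂ] PiLp 2 (fun _ : Fin r => H)}
    {Φ : X → Matrix (Fin r) (Fin r) ℂ} (hT : ∀ f p z, T f p z = ∑ q, Φ z p q * f q z) :
    ∃ Ψ : Matrix (Fin r) (Fin r) (Mult H), Mult.matrixOp Ψ = T ∧ ∀ z p q, Ψ p q z = Φ z p q := by
  have hmem (p q) : (fun z => Φ z p q) ∈ multiplierSubalgebra H := fun f => by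
    refine ⟨T (WithLp.toLp 2 (Pi.single q f)) p, fun z => ?_⟩
    rw [hT, Finset.sum_eq_single q (fun q' _ hq => by simp [hq]) (by simp)]
    simp
  let Ψ : Matrix (Fin r) (Fin r) (Mult H) := fun p q => ⟨fun z => Φ z p q, hmem p q⟩
  refine ⟨Ψ, ?_, fun _ _ _ => rfl⟩
  refine ContinuousLinearMap.ext fun f => PiLp.ext fun p => RKHS.ext fun z => ?_
  rw [hT, Mult.matrixOp_apply, ← RKHS.coeCLM_apply (𝕜 := ℂ), map_sum, Finset.sum_apply]
  exact Finset.sum_congr rfl fun q _ => Mult.mulOp_apply _ _ _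

theorem Mult.exists_norm_matrixOp_le_one {v : X × Fin r → EuclideanSpace ℂ (Fin r)}
    (h : (Matrix.of fun s t : X × Fin r => scalarKernel H s.1 t.1 *
      ((1 : Matrix (Fin r) (Fin r) ℂ) s.2 t.2 - inner ℂ (v s) (v t))).PosSemidef) :
    ∃ Ψ : Matrix (Fin r) (Fin r) (Mult H),
      ‖Mult.matrixOp Ψ‖ ≤ 1 ∧ ∀ z p q, Ψ p q z = star (v (z, p) q) := by
  have hgram : (Matrix.gram ℂ (fun s : X × Fin r => vectorKernel H s.1 (.single s.2 1)) -
      Matrix.gram ℂ (fun s : X × Fin r => vectorKernel H s.1 (v s))).PosSemidef := by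
    convert! h using 1
    ext s t
    have hsingle : inner ℂ (EuclideanSpace.single s.2 (1 : ℂ)) (EuclideanSpace.single t.2 1) =
        (1 : Matrix (Fin r) (Fin r) ℂ) s.2 t.2 := by
      simp [EuclideanSpace.inner_single_left, Matrix.one_apply]
    simp only [Matrix.sub_apply, Matrix.gram_apply, inner_vectorKernel, hsingle, Matrix.of_apply,
      mul_sub]
  obtain ⟨V, hV, hVk⟩ := exists_contraction_of_posSemidef hgram
  have hT (f p z) : V.adjoint f p z = ∑ q, star (v (z, p) q) * f q z := by
    rw [← vectorKernel_inner, ← hVk (z, p), ← ContinuousLinearMap.adjoint_inner_right,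
      vectorKernel_inner]
    simp
  obtain ⟨Ψ, hΨ, hval⟩ := Mult.exists_matrixOp_eq
    (Φ := fun z => Matrix.of fun p q => star (v (z, p) q)) hT
  exact ⟨Ψ, by rw [hΨ, LinearIsometryEquiv.norm_map]; exact hV, hval⟩

/-- The **McCullough–Quiggin theorem**: the lurking contraction `V` of the interpolation data
extends to every point of `X` by solving a fixed-point equation, because `‖β z‖ < 1`. -/
theorem IsCompletePick.of_kernel_mul_one_sub_inner_eq_one {β : X → E}
    (hβ : ∀ z w, scalarKernel H z w * (1 - inner ℂ (β z) (β w)) = 1) : IsCompletePick H := by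
  intro r n z W hP
  simp_rw [scalarKernel_eq_inner] at hβ hP
  let w (s : Fin n × Fin r) : EuclideanSpace ℂ (Fin r) := .toLp 2 fun q => star (W s.1 s.2 q)
  let e (p : Fin r) : EuclideanSpace ℂ (Fin r) := .single p 1
  have hw (s t) : inner ℂ (w s) (w t) = (W s.1 * (W t.1).conjTranspose) s.2 t.2 := by
    simp [w, PiLp.inner_apply, Matrix.mul_apply, mul_comm]
  have he (p q) : inner ℂ (e p) (e q) = (1 : Matrix (Fin r) (Fin r) ℂ) p q := by
    simp [e, EuclideanSpace.inner_single_left, Matrix.one_apply]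
  obtain ⟨l, hl⟩ := exists_gram_eq hP
  have hgram := gram_tmul_prod_eq (fun s t => hβ (z s.1) (z t.1)) (m := l) (v := w)
    (d := fun s => e s.2) fun s t => by
      rw [hw, he, ← Matrix.gram_apply, hl, Matrix.of_apply, Matrix.sub_apply]
  obtain ⟨V, hV, hVw⟩ := exists_contraction_of_posSemidef
    (sub_eq_zero.2 hgram ▸ Matrix.PosSemidef.zero)
  choose m hm hm_unique using fun s : X × Fin r => existsUnique_fst_apply_tmul_eq hV
    (norm_lt_one_of_inner_mul_one_sub_inner_eq_one (hβ s.1 s.1)) (e s.2)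
  let v (s : X × Fin r) := (V (.toLp 2 (m s ⊗ₜ β s.1, e s.2))).snd
  have hVm (s) : V (.toLp 2 (m s ⊗ₜ β s.1, e s.2)) = .toLp 2 (m s, v s) :=
    WithLp.ofLp_injective 2 (Prod.ext (hm s) rfl)
  have hpos := posSemidef_kernel_mul_sub (fun s t : X × Fin r => hβ s.1 t.1) (m := m) (v := v)
    (d := fun s => e s.2) (by
      simpa only [Function.comp_def, hVm] using posSemidef_gram_sub_gram_map
        (fun s : X × Fin r => WithLp.toLp 2 (m s ⊗ₜ[ℂ] β s.1, e s.2)) hV)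
  obtain ⟨Ψ, hΨ, hval⟩ := Mult.exists_norm_matrixOp_le_one (H := H) (v := v) (by
    simpa only [scalarKernel_eq_inner, he] using hpos)
  refine ⟨Ψ, hΨ, fun i p q => ?_⟩
  have hmi : m (z i, p) = l (i, p) := (hm_unique _ _ (by simp [hVw (i, p)])).symm
  have hvi : v (z i, p) = w (i, p) := by simp [v, hmi, hVw (i, p)]
  rw [hval, hvi]
  exact star_star _

end Pick

section LogConvex

open Filter Topology

/-- A positive log-convex sequence, i.e. one whose quotients `a (k + 1) / a k` increase. -/
structure IsLogConvexSeq (a : ℕ → ℝ) : Prop where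
  pos (k : ℕ) : 0 < a k
  sq_le (k : ℕ) : a (k + 1) ^ 2 ≤ a k * a (k + 2)

theorem isLogConvexSeq_tsum {ι : Type*} {c x : ι → ℝ} (hc : ∀ i, 0 ≤ c i) (hx : ∀ i, 0 ≤ x i)
    (hs : ∀ k, Summable fun i => c i * x i ^ k) (hpos : ∀ k, 0 < ∑' i, c i * x i ^ k) :
    IsLogConvexSeq fun k => ∑' i, c i * x i ^ k := by
  refine ⟨hpos, fun k => ?_⟩
  have hquad (t : ℝ) : 0 ≤ (∑' i, c i * x i ^ k) * (t * t) +
      (-2 * ∑' i, c i * x i ^ (k + 1)) * t + ∑' i, c i * x i ^ (k + 2) := by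
    have h := (((hs k).hasSum.mul_right (t * t)).add
      (((hs (k + 1)).hasSum.mul_left (-2)).mul_right t)).add (hs (k + 2)).hasSum
    refine h.nonneg fun i => ?_
    have : 0 ≤ c i * x i ^ k * (x i - t) ^ 2 :=
      mul_nonneg (mul_nonneg (hc i) (pow_nonneg (hx i) k)) (sq_nonneg _)
    linear_combination this
  have hdiscrim := discrim_le_zero hquad
  rw [discrim] at hdiscrim
  linarith

open Finset PowerSeries in
theorem eq_add_sum_of_one_sub_mk_mul_mk_eq_one {a b : ℕ → ℝ}
    (h : (1 - PowerSeries.mk b) * PowerSeries.mk a = 1) (n : ℕ) :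
    a n = (if n = 0 then 1 else 0) + ∑ i ∈ range (n + 1), b i * a (n - i) := by
  have hn := congrArg (coeff n) h
  rw [sub_mul, one_mul, map_sub, coeff_mul, coeff_one, sub_eq_iff_eq_add] at hn
  simp only [coeff_mk] at hn
  rwa [Nat.sum_antidiagonal_eq_sum_range_succ fun i j => b i * a j] at hn

open Finset in
theorem sum_range_mul_le_of_one_sub_mk_mul_mk_eq_one {a b : ℕ → ℝ}
    (h : (1 - PowerSeries.mk b) * PowerSeries.mk a = 1) (n : ℕ) :
    ∑ i ∈ range (n + 1), b i * a (n - i) ≤ a n := by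
  rw [eq_add_sum_of_one_sub_mk_mul_mk_eq_one h n]
  exact le_add_of_nonneg_left (by split_ifs <;> norm_num)

open Finset in
theorem le_of_one_sub_mk_mul_mk_eq_one {a b : ℕ → ℝ} (ha : ∀ n, 0 ≤ a n) (h0 : a 0 = 1)
    (hb : ∀ n, 0 ≤ b n) (h : (1 - PowerSeries.mk b) * PowerSeries.mk a = 1) (n : ℕ) :
    b n ≤ a n :=
  calc b n = b n * a (n - n) := by rw [Nat.sub_self, h0, mul_one]
    _ ≤ ∑ i ∈ range (n + 1), b i * a (n - i) :=
        single_le_sum (f := fun i => b i * a (n - i)) (fun i _ => mul_nonneg (hb i) (ha _))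
          (self_mem_range_succ n)
    _ ≤ a n := sum_range_mul_le_of_one_sub_mk_mul_mk_eq_one h n

namespace IsLogConvexSeq

variable {a : ℕ → ℝ} (ha : IsLogConvexSeq a)
include ha

theorem monotone_ratio : Monotone fun k => a (k + 1) / a k := by
  refine monotone_nat_of_le_succ fun k => ?_
  rw [div_le_div_iff₀ (ha.pos _) (ha.pos _)]
  linarith [ha.sq_le k]

theorem mul_le_mul_of_le {i j : ℕ} (h : i ≤ j) : a (i + 1) * a j ≤ a (j + 1) * a i :=
  (div_le_div_iff₀ (ha.pos i) (ha.pos j)).1 (ha.monotone_ratio h)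

theorem div_const {r : ℝ} (hr : 0 < r) : IsLogConvexSeq fun k => a k / r where
  pos k := div_pos (ha.pos k) hr
  sq_le k := by
    rw [div_pow, div_mul_div_comm, ← sq]
    exact div_le_div_of_nonneg_right (ha.sq_le k) (sq_nonneg r)

theorem ratio_le_one_of_summable (hs : Summable a) (k : ℕ) : a (k + 1) / a k ≤ 1 := by
  by_contra! hk
  refine not_summable_of_ratio_norm_eventually_ge hk
    (Eventually.of_forall fun n => norm_ne_zero_iff.2 (ha.pos n).ne').frequently ?_ hs
  filter_upwards [eventually_ge_atTop k] with n hn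
  rw [Real.norm_of_nonneg (ha.pos _).le, Real.norm_of_nonneg (ha.pos _).le,
    ← le_div_iff₀ (ha.pos n)]
  exact ha.monotone_ratio hn

theorem tendsto_ratio (hs : Summable a)
    (hr : ∀ L < 1, ∃ c r : ℝ, 0 < c ∧ L < r ∧ ∀ k, c * r ^ k ≤ a k) :
    Tendsto (fun k => a k / a (k + 1)) atTop (𝓝 1) := by
  suffices Tendsto (fun k => a (k + 1) / a k) atTop (𝓝 1) by
    simpa using this.inv₀ one_ne_zero
  refine tendsto_order.2 ⟨fun L hL => ?_, fun L hL =>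
    Eventually.of_forall fun k => (ha.ratio_le_one_of_summable hs k).trans_lt hL⟩
  by_contra hcon
  have hratio (k : ℕ) : a (k + 1) / a k ≤ L := by
    by_contra! hk
    exact hcon ((eventually_ge_atTop k).mono fun m hm => hk.trans_le (ha.monotone_ratio hm))
  have hL0 : 0 < L := (div_pos (ha.pos 1) (ha.pos 0)).trans_le (hratio 0)
  have hle (k : ℕ) : a k ≤ L ^ k * a 0 :=
    le_geom hL0.le k fun i _ => (div_le_iff₀ (ha.pos i)).1 (hratio i)
  obtain ⟨c, r, hc, hLr, hcr⟩ := hr L hL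
  obtain ⟨k, hk⟩ := ((tendsto_pow_atTop_atTop_of_one_lt
    ((one_lt_div hL0).2 hLr)).eventually_gt_atTop (a 0 / c)).exists
  rw [div_pow, div_lt_div_iff₀ hc (pow_pos hL0 k)] at hk
  linarith [hcr k, hle k]

open Finset in
/-- Kaluza's lemma. -/
theorem nonneg_of_one_sub_mk_mul_mk_eq_one (h0 : a 0 = 1) {b : ℕ → ℝ}
    (h : (1 - PowerSeries.mk b) * PowerSeries.mk a = 1) (n : ℕ) : 0 ≤ b n := by
  induction n using Nat.strong_induction_on with | _ n ih =>
  cases n with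
  | zero =>
    have hb0 := eq_add_sum_of_one_sub_mk_mul_mk_eq_one h 0
    rw [zero_add, sum_range_one, if_pos rfl, h0, mul_one] at hb0
    linarith
  | succ n =>
    have hlast : b (n + 1) = a (n + 1) - ∑ i ∈ range (n + 1), b i * a (n + 1 - i) := by
      rw [eq_add_sum_of_one_sub_mk_mul_mk_eq_one h (n + 1), sum_range_succ, Nat.sub_self, h0,
        if_neg n.succ_ne_zero]
      ring
    refine nonneg_of_mul_nonneg_right (a := a n) ?_ (ha.pos n)
    calc (0 : ℝ) ≤ a (n + 1) * ∑ i ∈ range (n + 1), b i * a (n - i) -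
          a n * ∑ i ∈ range (n + 1), b i * a (n + 1 - i) := by
          rw [mul_sum, mul_sum, ← sum_sub_distrib]
          refine sum_nonneg fun i hi => ?_
          have hratio := mul_le_mul_of_nonneg_left (ha.mul_le_mul_of_le (Nat.sub_le n i))
            (ih i (mem_range.1 hi))
          rw [Nat.succ_sub (Nat.lt_succ_iff.1 (mem_range.1 hi))]
          linarith
      _ ≤ a (n + 1) * a n - a n * ∑ i ∈ range (n + 1), b i * a (n + 1 - i) := by
          grw [sum_range_mul_le_of_one_sub_mk_mul_mk_eq_one h n]
          exact (ha.pos _).le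
      _ = a n * b (n + 1) := by rw [hlast]; ring

theorem exists_one_sub_mk_mul_mk_eq_one (h0 : a 0 = 1) :
    ∃ b : ℕ → ℝ, (∀ n, 0 ≤ b n) ∧ (1 - PowerSeries.mk b) * PowerSeries.mk a = 1 := by
  let b (n : ℕ) : ℝ := PowerSeries.coeff n (1 - (PowerSeries.mk a)⁻¹)
  have hb : (1 - PowerSeries.mk b) * PowerSeries.mk a = 1 := by
    rw [show PowerSeries.mk b = 1 - (PowerSeries.mk a)⁻¹ from PowerSeries.ext fun n =>
      PowerSeries.coeff_mk n b, sub_sub_cancel]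
    exact PowerSeries.inv_mul_cancel _ (by simp [h0])
  exact ⟨b, ha.nonneg_of_one_sub_mk_mul_mk_eq_one h0 hb, hb⟩

end IsLogConvexSeq

theorem le_one_of_forall_mul_pow_le {a : ℕ → ℝ} (ha : ∀ n, 0 < a n)
    (hr : Tendsto (fun n => a n / a (n + 1)) atTop (𝓝 1)) {x C : ℝ}
    (h : ∀ n, a n * x ^ n ≤ C) : x ≤ 1 := by
  by_contra! hx
  obtain ⟨y, hy1, hyx⟩ := exists_between hx
  have hy0 : 0 < y := one_pos.trans hy1
  have hx0 : 0 < x := hy0.trans hyx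
  have hpos (n : ℕ) : 0 < a n * y ^ n := mul_pos (ha n) (pow_pos hy0 n)
  have hlim : Tendsto (fun n => ‖a (n + 1) * y ^ (n + 1)‖ / ‖a n * y ^ n‖) atTop (𝓝 y) := by
    have := (hr.inv₀ one_ne_zero).mul_const y
    rw [inv_one, one_mul] at this
    refine this.congr fun n => ?_
    rw [Real.norm_of_nonneg (hpos _).le, Real.norm_of_nonneg (hpos _).le, inv_div, pow_succ',
      ← mul_assoc, mul_div_mul_right _ _ (pow_pos hy0 n).ne', mul_div_right_comm]
  refine not_summable_of_ratio_test_tendsto_gt_one hy1 hlim (.of_nonneg_of_le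
    (fun n => (hpos n).le) (fun n => ?_) ((summable_geometric_of_lt_one (div_pos hy0 hx0).le
      ((div_lt_one hx0).2 hyx)).mul_left C))
  calc a n * y ^ n = a n * x ^ n * (y / x) ^ n := by
        rw [div_pow, mul_assoc, mul_div_cancel₀ _ (pow_pos hx0 n).ne']
    _ ≤ C * (y / x) ^ n := mul_le_mul_of_nonneg_right (h n) (by positivity)

end LogConvex

section MultiplierNorm

namespace Mult

open Filter Topology

variable {X : Type*} {H : Type*} [NormedAddCommGroup H] [InnerProductSpace ℂ H]
  [RKHS ℂ H X ℂ] [CompleteSpace H]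

theorem norm_apply_le (hH : ∀ x : X, ∃ f : H, f x ≠ 0) (φ : Mult H) (x : X) : ‖φ x‖ ≤ ‖φ‖ := by
  let k := RKHS.kerFun H x (1 : ℂ)
  have hk (f : H) : inner ℂ k f = f x := by simp [k, RKHS.kerFun_inner]
  have hk0 : k ≠ 0 := fun h => by
    obtain ⟨f, hf⟩ := hH x
    exact hf (by rw [← hk, h, inner_zero_left])
  refine le_of_mul_le_mul_right ?_ (pow_pos (norm_pos_iff.2 hk0) 2)
  calc ‖φ x‖ * ‖k‖ ^ 2 = ‖inner ℂ k (φ.mulOp k)‖ := by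
        rw [hk, mulOp_apply, ← hk, norm_mul, inner_self_eq_norm_sq_to_K]
        simp
    _ ≤ ‖k‖ * ‖φ.mulOp k‖ := norm_inner_le_norm _ _
    _ ≤ ‖k‖ * (‖φ‖ * ‖k‖) := by grw [φ.mulOp.le_opNorm, norm_def]
    _ = ‖φ‖ * ‖k‖ ^ 2 := by ring

variable (H) in
/-- The multiplier norm is a norm when the functions in `H` have no common zero. -/
noncomputable abbrev normedCommRing (hH : ∀ x : X, ∃ f : H, f x ≠ 0) : NormedCommRing (Mult H) :=
  { (inferInstance : SeminormedCommRing (Mult H)) with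
    eq_of_dist_eq_zero := fun {φ ψ} h => Subtype.ext <| funext fun x => by
      rw [dist_eq_norm] at h
      exact sub_eq_zero.1 (norm_le_zero_iff.1 ((norm_apply_le hH (φ - ψ) x).trans_eq h)) }

theorem mulOp_smul (c : ℂ) (φ : Mult H) : (c • φ).mulOp = c • φ.mulOp := by
  ext f x
  rw [mulOp_apply, _root_.smul_apply, RKHS.coe_smul, Pi.smul_apply, mulOp_apply]
  exact smul_mul_assoc c (φ x) (f x)

noncomputable instance instNormedAlgebra : NormedAlgebra ℂ (Mult H) :=
  { (inferInstance : Algebra ℂ (Mult H)) with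
    norm_smul_le := fun c φ => by rw [norm_def, norm_def, mulOp_smul, norm_smul] }

theorem mem_range_mulHom_iff (hH : ∀ x : X, ∃ f : H, f x ≠ 0) (T : H →L[ℂ] H) :
    T ∈ Set.range (mulHom H) ↔ ∀ (f g : H) (x : X), T f x * g x = f x * T g x := by
  constructor
  · rintro ⟨φ, rfl⟩ f g x
    change φ.mulOp f x * g x = f x * φ.mulOp g x
    rw [mulOp_apply, mulOp_apply]
    ring
  · intro hT
    choose e he using hH
    have hTe (f : H) (x : X) : T f x = T (e x) x / e x x * f x := by
      rw [div_mul_eq_mul_div, eq_div_iff (he x), hT, mul_comm]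
    refine ⟨⟨fun x => T (e x) x / e x x, fun f => ⟨T f, hTe f⟩⟩,
      ContinuousLinearMap.ext fun f => RKHS.ext fun x => ?_⟩
    rw [hTe]
    exact mulOp_apply _ f x

theorem isometry_mulHom : Isometry (mulHom H) :=
  Isometry.of_dist_eq fun φ ψ => by rw [dist_eq_norm, dist_eq_norm, ← map_sub]; rfl

theorem completeSpace (hH : ∀ x : X, ∃ f : H, f x ≠ 0) : CompleteSpace (Mult H) := by
  rw [completeSpace_iff_isComplete_range isometry_mulHom.isUniformInducing]
  refine IsClosed.isComplete ?_
  have hrange : Set.range (mulHom H) = {T | ∀ (f g : H) (x : X), T f x * g x = f x * T g x} :=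
    Set.ext (mem_range_mulHom_iff hH)
  simp only [hrange, Set.ofPred_forall]
  have hcont (f : H) (x : X) : Continuous fun T : H →L[ℂ] H => T f x :=
    (RKHS.continuous_eval (H := H) x).comp (ContinuousLinearMap.apply ℂ H f).continuous
  exact isClosed_iInter fun f => isClosed_iInter fun g => isClosed_iInter fun x =>
    isClosed_eq ((hcont f x).mul_const _) ((hcont g x).const_mul _)

theorem exists_character_eq_zero (hH : ∀ x : X, ∃ f : H, f x ≠ 0) {φ : Mult H}
    (hφ : ¬IsUnit φ) : ∃ χ : MaximalIdealSpace H, χ φ = 0 := by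
  let := normedCommRing H hH
  have := completeSpace hH
  exact WeakDual.CharacterSpace.exists_apply_eq_zero hφ

/-- Evaluation at a point as a character of the multiplier algebra. -/
noncomputable def evalCharacter (hH : ∀ x : X, ∃ f : H, f x ≠ 0) (x : X) : MaximalIdealSpace H :=
  ⟨LinearMap.mkContinuous { toFun φ := φ x, map_add' _ _ := rfl, map_smul' _ _ := rfl } 1
      fun φ => by rw [one_mul]; exact norm_apply_le hH φ x,
    fun h => one_ne_zero (α := ℂ) (DFunLike.congr_fun h (1 : Mult H)), fun _ _ => rfl⟩

theorem evalCharacter_apply (hH : ∀ x : X, ∃ f : H, f x ≠ 0) (x : X) (φ : Mult H) :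
    evalCharacter hH x φ = φ x := rfl

end Mult

end MultiplierNorm

section PowerSeriesOnDisc

open Filter Topology PowerSeries Finset

/-- Power series with absolutely summable coefficients, i.e. elements of the Wiener algebra. -/
def AbsSummable (u : ℂ⟦X⟧) : Prop := Summable fun n => ‖coeff n u‖

/-- The sum of a power series at a point of the closed unit disc. The value is meaningful for
absolutely summable series, and only those are evaluated below. -/
noncomputable def evalDisc (u : ℂ⟦X⟧) (z : ℂ) : ℂ := ∑' n, coeff n u * z ^ n

variable {u v : ℂ⟦X⟧} {z : ℂ}

theorem norm_coeff_mul_pow_le (u : ℂ⟦X⟧) (hz : ‖z‖ ≤ 1) (n : ℕ) :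
    ‖coeff n u * z ^ n‖ ≤ ‖coeff n u‖ := by
  rw [norm_mul, norm_pow]
  exact mul_le_of_le_one_right (norm_nonneg _) (pow_le_one₀ (norm_nonneg _) hz)

theorem evalDisc_one (z : ℂ) : evalDisc 1 z = 1 := by
  rw [evalDisc, tsum_eq_single 0 fun n hn => by simp [coeff_one, hn]]
  simp

theorem evalDisc_X_pow (k : ℕ) (z : ℂ) : evalDisc (X ^ k) z = z ^ k := by
  rw [evalDisc, tsum_eq_single k fun n hn => by simp [coeff_X_pow, hn]]
  simp

theorem absSummable_one : AbsSummable 1 :=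
  summable_of_ne_finset_zero (s := {0}) fun n hn => by
    rw [coeff_one, if_neg (by simpa using hn), norm_zero]

namespace AbsSummable

theorem summable_norm_mul_pow (hu : AbsSummable u) (hz : ‖z‖ ≤ 1) :
    Summable fun n => ‖coeff n u * z ^ n‖ :=
  .of_nonneg_of_le (fun _ => norm_nonneg _) (norm_coeff_mul_pow_le u hz) hu

theorem hasSum_evalDisc (hu : AbsSummable u) (hz : ‖z‖ ≤ 1) :
    HasSum (fun n => coeff n u * z ^ n) (evalDisc u z) :=
  (hu.summable_norm_mul_pow hz).of_norm.hasSum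

theorem sub (hu : AbsSummable u) (hv : AbsSummable v) : AbsSummable (u - v) := by
  simp only [AbsSummable, map_sub]
  exact Summable.of_nonneg_of_le (fun _ => norm_nonneg _) (fun _ => norm_sub_le _ _)
    (Summable.add hu hv)

theorem mul (hu : AbsSummable u) (hv : AbsSummable v) : AbsSummable (u * v) := by
  simp only [AbsSummable, coeff_mul]
  exact summable_norm_sum_mul_antidiagonal_of_summable_norm (f := fun n => coeff n u)
    (g := fun n => coeff n v) hu hv

theorem evalDisc_sub (hu : AbsSummable u) (hv : AbsSummable v) (hz : ‖z‖ ≤ 1) :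
    evalDisc (u - v) z = evalDisc u z - evalDisc v z := by
  have h := (hu.hasSum_evalDisc hz).sub (hv.hasSum_evalDisc hz)
  simp only [← sub_mul, ← map_sub] at h
  exact h.tsum_eq

theorem evalDisc_mul (hu : AbsSummable u) (hv : AbsSummable v) (hz : ‖z‖ ≤ 1) :
    evalDisc (u * v) z = evalDisc u z * evalDisc v z := by
  simp only [evalDisc]
  rw [tsum_mul_tsum_eq_tsum_sum_antidiagonal_of_summable_norm
    (hu.summable_norm_mul_pow hz) (hv.summable_norm_mul_pow hz)]
  refine tsum_congr fun n => ?_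
  rw [coeff_mul, sum_mul]
  refine sum_congr rfl fun p hp => ?_
  rw [← mem_antidiagonal.1 hp, pow_add]
  ring

theorem norm_evalDisc_le (hu : AbsSummable u) (hz : ‖z‖ ≤ 1) :
    ‖evalDisc u z‖ ≤ ∑' n, ‖coeff n u‖ :=
  tsum_of_norm_bounded hu.hasSum (norm_coeff_mul_pow_le u hz)

theorem continuous_evalDisc (hu : AbsSummable u) : Continuous fun z : ClosedDisc => evalDisc u z :=
  continuous_tsum (fun n => by fun_prop) hu
    fun n z => norm_coeff_mul_pow_le u (mem_closedBall_zero_iff.1 z.2) n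

theorem hasFPowerSeriesAt (hu : AbsSummable u) : HasFPowerSeriesAt (evalDisc u)
    (FormalMultilinearSeries.ofScalars ℂ fun n => coeff n u) 0 := by
  rw [hasFPowerSeriesAt_iff]
  filter_upwards [Metric.closedBall_mem_nhds (0 : ℂ) one_pos] with z hz
  simpa [mul_comm] using hu.hasSum_evalDisc (mem_closedBall_zero_iff.1 hz)

theorem eq_of_evalDisc_eq (hu : AbsSummable u) (hv : AbsSummable v)
    (h : ∀ z : ClosedDisc, evalDisc u z = evalDisc v z) : u = v := by
  have hev : evalDisc u =ᶠ[𝓝 0] evalDisc v := by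
    filter_upwards [Metric.closedBall_mem_nhds (0 : ℂ) one_pos] with z hz using h ⟨z, hz⟩
  have hseries := (hu.hasFPowerSeriesAt.congr hev).eq_formalMultilinearSeries hv.hasFPowerSeriesAt
  exact PowerSeries.ext fun n => by simpa using congrArg (fun p => p.coeff n) hseries

end AbsSummable

end PowerSeriesOnDisc

section WeightedHardy

open Filter Topology PowerSeries Finset

theorem ClosedDisc.norm_le_one (z : ClosedDisc) : ‖(z : ℂ)‖ ≤ 1 := mem_closedBall_zero_iff.1 z.2

theorem ClosedDisc.norm_mul_star_le_one (z t : ClosedDisc) : ‖(z : ℂ) * star (t : ℂ)‖ ≤ 1 := by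
  rw [norm_mul, norm_star]
  exact mul_le_one₀ z.norm_le_one (norm_nonneg _) t.norm_le_one

theorem memℓp_sqrt_mul_star_pow {b : ℕ → ℝ} (hb : ∀ n, 0 ≤ b n) (hs : Summable b)
    (z : ClosedDisc) : Memℓp (fun n => (√(b n) : ℂ) * star (z : ℂ) ^ n) 2 := by
  rw [memℓp_gen_iff (by norm_num)]
  refine .of_nonneg_of_le (fun n => by positivity) (fun n => ?_) hs
  simp only [norm_mul, norm_pow, norm_star, Complex.norm_real, Real.norm_eq_abs,
    ENNReal.toReal_ofNat, Real.rpow_ofNat]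
  rw [mul_pow, sq_abs, Real.sq_sqrt (hb n)]
  exact mul_le_of_le_one_right (hb n)
    (pow_le_one₀ (by positivity) (pow_le_one₀ (norm_nonneg _) z.norm_le_one))

/-- The vectors `(√(b n) * conj z ^ n)`, whose Gram kernel is `∑ b n * (z * conj t) ^ n`. -/
noncomputable def sqrtPowVec {b : ℕ → ℝ} (hb : ∀ n, 0 ≤ b n) (hs : Summable b) (z : ClosedDisc) :
    lp (fun _ : ℕ => ℂ) 2 :=
  ⟨_, memℓp_sqrt_mul_star_pow hb hs z⟩

theorem inner_sqrtPowVec {b : ℕ → ℝ} (hb : ∀ n, 0 ≤ b n) (hs : Summable b) (z : ClosedDisc)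
    (f : lp (fun _ : ℕ => ℂ) 2) :
    inner ℂ (sqrtPowVec hb hs z) f = evalDisc (mk fun n => (√(b n) : ℂ) * f n) z := by
  rw [lp.inner_eq_tsum (𝕜 := ℂ), evalDisc]
  refine tsum_congr fun n => ?_
  simp [sqrtPowVec]
  ring

theorem inner_sqrtPowVec_sqrtPowVec {b : ℕ → ℝ} (hb : ∀ n, 0 ≤ b n) (hs : Summable b)
    (z t : ClosedDisc) :
    inner ℂ (sqrtPowVec hb hs z) (sqrtPowVec hb hs t) =
      evalDisc (mk fun n => (b n : ℂ)) (z * star (t : ℂ)) := by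
  rw [inner_sqrtPowVec, evalDisc, evalDisc]
  refine tsum_congr fun n => ?_
  have hsq : (√(b n) : ℂ) * √(b n) = b n := by exact_mod_cast Real.mul_self_sqrt (hb n)
  rw [coeff_mk, coeff_mk, sqrtPowVec, ← mul_assoc, hsq, mul_pow]
  ring

/-- A positive summable weight sequence. -/
structure SummableWeight where
  a : ℕ → ℝ
  pos (n : ℕ) : 0 < a n
  summable : Summable a

theorem SummableWeight.sqrt_ne_zero (w : SummableWeight) (n : ℕ) : (√(w.a n) : ℂ) ≠ 0 :=
  Complex.ofReal_ne_zero.2 (Real.sqrt_pos.2 (w.pos n)).ne'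

/-- The Hilbert space of power series `∑ f n * z ^ n` with norm `∑ ‖f n‖ ^ 2 / a n`, represented by
the coordinates with respect to the orthonormal basis `√(a n) * z ^ n`. -/
def WeightedHardy (_w : SummableWeight) : Type := lp (fun _ : ℕ => ℂ) 2

namespace WeightedHardy

variable {w : SummableWeight}

noncomputable instance : NormedAddCommGroup (WeightedHardy w) :=
  inferInstanceAs (NormedAddCommGroup (lp (fun _ : ℕ => ℂ) 2))

noncomputable instance : InnerProductSpace ℂ (WeightedHardy w) :=
  inferInstanceAs (InnerProductSpace ℂ (lp (fun _ : ℕ => ℂ) 2))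

instance : CompleteSpace (WeightedHardy w) :=
  inferInstanceAs (CompleteSpace (lp (fun _ : ℕ => ℂ) 2))

/-- The Taylor series of an element of the space. -/
noncomputable def series (f : WeightedHardy w) : ℂ⟦X⟧ := mk fun n => (√(w.a n) : ℂ) * f.1 n

theorem norm_coeff_series_sq_div (f : WeightedHardy w) (n : ℕ) :
    ‖coeff n f.series‖ ^ 2 / w.a n = ‖f.1 n‖ ^ 2 := by
  rw [series, coeff_mk, norm_mul, mul_pow, Complex.norm_real, Real.norm_eq_abs, sq_abs,
    Real.sq_sqrt (w.pos n).le, mul_div_cancel_left₀ _ (w.pos n).ne']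

theorem hasSum_norm_coeff_sq_div (f : WeightedHardy w) :
    HasSum (fun n => ‖coeff n f.series‖ ^ 2 / w.a n) (‖f‖ ^ 2) := by
  simp_rw [norm_coeff_series_sq_div]
  simpa using! lp.hasSum_norm (p := 2) (by norm_num) (f : lp (fun _ : ℕ => ℂ) 2)

theorem exists_series_eq {u : ℂ⟦X⟧} (hu : Summable fun n => ‖coeff n u‖ ^ 2 / w.a n) :
    ∃ f : WeightedHardy w, f.series = u := by
  have hm : Memℓp (fun n => coeff n u / (√(w.a n) : ℂ)) 2 := by
    rw [memℓp_gen_iff (by norm_num)]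
    exact hu.congr fun n => by simp [div_pow, Real.sq_sqrt (w.pos n).le]
  refine ⟨(⟨_, hm⟩ : lp (fun _ : ℕ => ℂ) 2), PowerSeries.ext fun n => ?_⟩
  exact (coeff_mk _ _).trans (mul_div_cancel₀ _ (w.sqrt_ne_zero n))

theorem series_injective : Function.Injective (series : WeightedHardy w → ℂ⟦X⟧) :=
  fun f g h => Subtype.ext <| funext fun n => mul_left_cancel₀ (w.sqrt_ne_zero n) <| by
    simpa only [series, coeff_mk] using congrArg (coeff n) h

theorem absSummable_series (f : WeightedHardy w) : AbsSummable f.series := by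
  refine .of_nonneg_of_le (fun _ => norm_nonneg _) (fun n => ?_)
    (w.summable.add f.hasSum_norm_coeff_sq_div.summable)
  have ha := w.pos n
  rw [← mul_le_mul_iff_left₀ ha, add_mul, div_mul_cancel₀ _ ha.ne']
  nlinarith [sq_nonneg (w.a n - ‖coeff n f.series‖), norm_nonneg (coeff n f.series)]

/-- The element representing evaluation at a point of the disc. -/
noncomputable def kernelVec (z : ClosedDisc) : WeightedHardy w :=
  sqrtPowVec (fun n => (w.pos n).le) w.summable z

theorem inner_kernelVec (z : ClosedDisc) (f : WeightedHardy w) :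
    inner ℂ (kernelVec z) f = evalDisc f.series z :=
  inner_sqrtPowVec _ _ z f

noncomputable instance : RKHS ℂ (WeightedHardy w) ClosedDisc ℂ where
  coeCLM := ContinuousLinearMap.pi fun z => innerSL ℂ (kernelVec z)
  coeCLM_injective := fun f g h => series_injective <|
    f.absSummable_series.eq_of_evalDisc_eq g.absSummable_series fun z => by
      rw [← inner_kernelVec, ← inner_kernelVec]
      exact congrFun h z

theorem apply_eq_inner (f : WeightedHardy w) (z : ClosedDisc) : f z = inner ℂ (kernelVec z) f := rfl

theorem apply_eq_evalDisc (f : WeightedHardy w) (z : ClosedDisc) : f z = evalDisc f.series z := by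
  rw [apply_eq_inner, inner_kernelVec]

theorem kerFun_one (z : ClosedDisc) : RKHS.kerFun (WeightedHardy w) z 1 = kernelVec z :=
  ext_inner_right ℂ fun f => by simp [RKHS.kerFun_inner, ← apply_eq_inner]

theorem scalarKernel_eq_evalDisc (z t : ClosedDisc) : scalarKernel (WeightedHardy w) z t =
    evalDisc (mk fun n => (w.a n : ℂ)) (z * star (t : ℂ)) := by
  rw [scalarKernel_eq_inner, kerFun_one, kerFun_one]
  exact inner_sqrtPowVec_sqrtPowVec _ _ z t

theorem absSummable_mk_ofReal {b : ℕ → ℝ} (hb : ∀ n, 0 ≤ b n) (hs : Summable b) :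
    AbsSummable (mk fun n => (b n : ℂ)) := by
  simpa [AbsSummable, abs_of_nonneg (hb _)] using hs

theorem hasSum_scalarKernel (z t : ClosedDisc) :
    HasSum (fun n => (w.a n : ℂ) * ((z : ℂ) * star (t : ℂ)) ^ n)
      (scalarKernel (WeightedHardy w) z t) := by
  rw [scalarKernel_eq_evalDisc]
  simpa only [coeff_mk] using (absSummable_mk_ofReal (fun n => (w.pos n).le)
    w.summable).hasSum_evalDisc (z.norm_mul_star_le_one t)

theorem isCompletePick (hw : IsLogConvexSeq w.a) (h0 : w.a 0 = 1) :
    IsCompletePick (WeightedHardy w) := by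
  obtain ⟨b, hb, hba⟩ := hw.exists_one_sub_mk_mul_mk_eq_one h0
  have ha (n : ℕ) : 0 ≤ w.a n := (w.pos n).le
  have hs : Summable b :=
    .of_nonneg_of_le hb (le_of_one_sub_mk_mul_mk_eq_one ha h0 hb hba) w.summable
  refine .of_kernel_mul_one_sub_inner_eq_one (β := sqrtPowVec hb hs) fun z t => ?_
  have hz := z.norm_mul_star_le_one t
  have hbA := absSummable_mk_ofReal hb hs
  have hmap (c : ℕ → ℝ) : PowerSeries.map Complex.ofRealHom (mk c) = mk fun n => (c n : ℂ) := by
    ext; simp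
  have hmul : (1 - mk fun n => (b n : ℂ)) * (mk fun n => (w.a n : ℂ)) = 1 := by
    simpa [hmap] using congrArg (PowerSeries.map Complex.ofRealHom) hba
  rw [scalarKernel_eq_evalDisc, inner_sqrtPowVec_sqrtPowVec, mul_comm, ← evalDisc_one,
    ← absSummable_one.evalDisc_sub hbA hz, ← (absSummable_one.sub hbA).evalDisc_mul
      (absSummable_mk_ofReal ha w.summable) hz, hmul]

theorem forall_apply_eq_mul_iff {u : ℂ⟦X⟧} (hu : AbsSummable u) (h f : WeightedHardy w) :
    (∀ z : ClosedDisc, h z = evalDisc u z * f z) ↔ h.series = u * f.series := by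
  simp only [apply_eq_evalDisc]
  constructor
  · intro H
    refine h.absSummable_series.eq_of_evalDisc_eq (hu.mul f.absSummable_series) fun z => ?_
    rw [H, hu.evalDisc_mul f.absSummable_series z.norm_le_one]
  · intro H z
    rw [H, hu.evalDisc_mul f.absSummable_series z.norm_le_one]

/-- The monomial `z ^ k`. -/
noncomputable def monomial (k : ℕ) : WeightedHardy w :=
  lp.single (E := fun _ : ℕ => ℂ) 2 k (√(w.a k) : ℂ)⁻¹

theorem series_monomial (k : ℕ) : (monomial k : WeightedHardy w).series = X ^ k := by
  ext n
  rw [series, coeff_mk, coeff_X_pow, monomial, lp.coeFn_single]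
  split_ifs with h
  · subst h
    rw [Pi.single_eq_same, mul_inv_cancel₀ (w.sqrt_ne_zero n)]
  · rw [Pi.single_eq_of_ne h, mul_zero]

theorem monomial_apply (k : ℕ) (z : ClosedDisc) :
    (monomial k : WeightedHardy w) z = (z : ℂ) ^ k := by
  rw [apply_eq_evalDisc, series_monomial, evalDisc_X_pow]

theorem inner_monomial (k : ℕ) (f : WeightedHardy w) :
    inner ℂ (monomial k) f = coeff k f.series / w.a k := by
  have hsq : (√(w.a k) : ℂ) * √(w.a k) = w.a k := by
    exact_mod_cast Real.mul_self_sqrt (w.pos k).le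
  have h : inner ℂ (monomial k) f = inner ℂ (√(w.a k) : ℂ)⁻¹ (f.1 k) :=
    lp.inner_single_left k _ _
  rw [h, series, coeff_mk, ← hsq, mul_div_mul_left _ _ (w.sqrt_ne_zero k)]
  simp [div_eq_mul_inv]

theorem norm_monomial_sq (k : ℕ) : ‖(monomial k : WeightedHardy w)‖ ^ 2 = 1 / w.a k := by
  have h := inner_monomial k (monomial k : WeightedHardy w)
  rw [series_monomial, coeff_X_pow_self, inner_self_eq_norm_sq_to_K] at h
  exact Complex.ofReal_injective (by simpa using h)

theorem ext_inner_monomial {f g : WeightedHardy w}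
    (h : ∀ k, inner ℂ (monomial k) f = inner ℂ (monomial k) g) : f = g :=
  series_injective <| PowerSeries.ext fun k =>
    (div_left_inj' (Complex.ofReal_ne_zero.2 (w.pos k).ne')).1 (by
      simpa only [inner_monomial] using h k)

theorem isMaximalDomain (hr : Tendsto (fun n => w.a n / w.a (n + 1)) atTop (𝓝 1)) :
    IsMaximalDomain (WeightedHardy w) := by
  intro ρ ⟨hρ0, hρ⟩
  have hone : ρ (monomial 0) = 1 := by
    obtain ⟨f, hf⟩ := DFunLike.exists_ne hρ0
    refine mul_left_cancel₀ hf ?_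
    rw [← hρ f (monomial 0) f fun x => by simp [monomial_apply], mul_one]
  have hpow (k : ℕ) : ρ (monomial k) = ρ (monomial 1) ^ k := by
    induction k with
    | zero => rw [hone, pow_zero]
    | succ k ih =>
      rw [pow_succ, ← ih]
      exact hρ _ _ _ fun x => by simp [monomial_apply, pow_succ]
  have hle : ‖ρ (monomial 1)‖ ^ 2 ≤ 1 :=
    le_one_of_forall_mul_pow_le w.pos hr (C := ‖ρ‖ ^ 2) fun n => by
      calc w.a n * (‖ρ (monomial 1)‖ ^ 2) ^ n = w.a n * ‖ρ (monomial n)‖ ^ 2 := by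
            rw [hpow n, norm_pow, ← pow_mul, ← pow_mul, mul_comm 2]
        _ ≤ w.a n * (‖ρ‖ * ‖(monomial n : WeightedHardy w)‖) ^ 2 := by
            have := (w.pos n).le
            grw [ρ.le_opNorm]
        _ = ‖ρ‖ ^ 2 := by
            rw [mul_pow, norm_monomial_sq, mul_left_comm, mul_one_div_cancel (w.pos n).ne', mul_one]
  let z : ClosedDisc :=
    ⟨ρ (monomial 1), mem_closedBall_zero_iff.2 ((sq_le_one_iff₀ (norm_nonneg _)).1 hle)⟩
  have hriesz : (InnerProductSpace.toDual ℂ _).symm ρ = kernelVec z := by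
    refine ext_inner_monomial fun k => ?_
    rw [← inner_conj_symm, InnerProductSpace.toDual_symm_apply, ← inner_conj_symm _ (kernelVec z),
      ← apply_eq_inner, monomial_apply, hpow]
  exact ⟨z, fun f => by rw [apply_eq_inner, ← hriesz, InnerProductSpace.toDual_symm_apply]⟩

end WeightedHardy

end WeightedHardy

namespace WeightedHardy

open Filter Topology PowerSeries

variable {w : SummableWeight}

theorem exists_apply_ne_zero (z : ClosedDisc) : ∃ f : WeightedHardy w, f z ≠ 0 :=
  ⟨monomial 0, by simp [monomial_apply]⟩

theorem exists_mult_eq_evalDisc {u : ℂ⟦X⟧}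
    (hu : ∀ f : WeightedHardy w, Summable fun n => ‖coeff n (u * f.series)‖ ^ 2 / w.a n) :
    ∃ φ : Mult (WeightedHardy w), ∀ z : ClosedDisc, φ z = evalDisc u z := by
  have habs : AbsSummable u := by
    obtain ⟨h, hh⟩ := exists_series_eq (hu (monomial 0))
    rw [series_monomial, pow_zero, mul_one] at hh
    exact hh ▸ h.absSummable_series
  refine ⟨⟨fun z => evalDisc u z, fun f => ?_⟩, fun z => rfl⟩
  obtain ⟨g, hg⟩ := exists_series_eq (hu f)
  exact ⟨g, (forall_apply_eq_mul_iff habs g f).2 hg⟩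

theorem exists_mult_eq_coe (hr : Tendsto (fun n => w.a n / w.a (n + 1)) atTop (𝓝 1)) :
    ∃ φ : Mult (WeightedHardy w), ∀ z : ClosedDisc, φ z = z := by
  obtain ⟨C, hC⟩ := hr.bddAbove_range
  have hbound (n : ℕ) : w.a n / w.a (n + 1) ≤ C := hC ⟨n, rfl⟩
  have hu (f : WeightedHardy w) :
      Summable fun n => ‖coeff n ((X : ℂ⟦X⟧) * f.series)‖ ^ 2 / w.a n := by
    rw [← summable_nat_add_iff 1]
    refine .of_nonneg_of_le (fun n => div_nonneg (sq_nonneg _) (w.pos _).le) (fun n => ?_)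
      (f.hasSum_norm_coeff_sq_div.summable.mul_left C)
    rw [coeff_succ_X_mul]
    calc ‖coeff n f.series‖ ^ 2 / w.a (n + 1)
        = w.a n / w.a (n + 1) * (‖coeff n f.series‖ ^ 2 / w.a n) := by
          rw [div_mul_div_comm, mul_comm (w.a (n + 1)), mul_div_mul_left _ _ (w.pos n).ne']
      _ ≤ C * (‖coeff n f.series‖ ^ 2 / w.a n) :=
          mul_le_mul_of_nonneg_right (hbound n) (div_nonneg (sq_nonneg _) (w.pos n).le)
  obtain ⟨φ, hφ⟩ := exists_mult_eq_evalDisc hu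
  exact ⟨φ, fun z => by simpa [hφ] using evalDisc_X_pow 1 z⟩

theorem continuous_coe (f : WeightedHardy w) : Continuous f := by
  rw [funext f.apply_eq_evalDisc]
  exact f.absSummable_series.continuous_evalDisc

theorem continuous_mult (φ : Mult (WeightedHardy w)) : Continuous φ :=
  (continuous_coe (φ.mulOp (monomial 0))).congr fun z => by
    rw [Mult.mulOp_apply, monomial_apply, pow_zero, mul_one]

theorem isEmbedding_evalCharacter {φ : Mult (WeightedHardy w)}
    (hφ : ∀ z : ClosedDisc, φ z = z) :
    IsEmbedding (Mult.evalCharacter (H := WeightedHardy w) exists_apply_ne_zero) := by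
  have hcont : Continuous (Mult.evalCharacter (H := WeightedHardy w) exists_apply_ne_zero) :=
    Continuous.subtype_mk (WeakDual.continuous_of_continuous_eval continuous_mult) _
  refine (hcont.isClosedEmbedding fun z t h => Subtype.ext ?_).isEmbedding
  rw [← hφ z, ← hφ t]
  exact congrArg (fun χ : MaximalIdealSpace (WeightedHardy w) => χ φ) h

end WeightedHardy

section BlockSystem

open Filter Topology Finset

/-- The data of the `j`-th block. On `[N, N + (j + 1) * n)` the weight is to be comparable to
`c * ρ ^ (2 * k)`, while `[n, 2 * n)` carries the `j`-th window of the test multiplier. -/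
structure Block (j : ℕ) where
  ρ : ℝ
  c : ℝ
  N : ℕ
  n : ℕ
  ρ_pos : 0 < ρ
  ρ_lt_one : ρ < 1
  one_sub_ρ_le : 1 - ρ ≤ (1 / 2) ^ j
  c_pos : 0 < c
  c_le : c ≤ (1 / 2) ^ j * (1 - ρ)
  n_pos : 0 < n
  ρ_pow_n_le : ρ ^ n ≤ (1 / 4) ^ (j + 1)
  N_le : (N : ℝ) ≤ (1 / 4) ^ j * n * c * ρ ^ (2 * N)

namespace Block

/-- Compatibility of consecutive blocks: the next coefficient is negligible on the current block,
and the next geometric sequence dominates all previous ones from the next block on. -/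
structure Precedes {j : ℕ} (s : Block j) (t : Block (j + 1)) : Prop where
  ρ_le : s.ρ ≤ t.ρ
  half_le_ρ_pow : 1 / 2 ≤ t.ρ ^ (4 * s.n)
  c_le : t.c ≤ s.c * s.ρ ^ (2 * (s.N + (j + 1) * s.n)) / 2
  N_le : s.N ≤ t.N
  two_mul_ρ_pow_le : 2 * s.ρ ^ (2 * t.N) ≤ t.c * t.ρ ^ (2 * t.N)
  two_mul_n_le : 2 * s.n ≤ t.n

variable {j : ℕ}

theorem exists_ρ_next (s : Block j) :
    ∃ ρ, s.ρ < ρ ∧ ρ < 1 ∧ 1 - ρ ≤ (1 / 2) ^ (j + 1) ∧ 1 / 2 ≤ ρ ^ (4 * s.n) := by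
  have hnear (L : ℝ) (hL : L < 1) : ∀ᶠ x in 𝓝[<] (1 : ℝ), L < x :=
    nhdsWithin_le_nhds (lt_mem_nhds hL)
  have hpow : Tendsto (fun x : ℝ => x ^ (4 * s.n)) (𝓝[<] 1) (𝓝 1) := by
    have h : ContinuousAt (fun x : ℝ => x ^ (4 * s.n)) 1 := by fun_prop
    simpa [ContinuousAt] using h.mono_left nhdsWithin_le_nhds
  have hhalf := hpow.eventually (lt_mem_nhds (show (1 / 2 : ℝ) < 1 by norm_num))
  have hgap : 1 - (1 / 2 : ℝ) ^ (j + 1) < 1 := sub_lt_self _ (by positivity)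
  obtain ⟨ρ, h1, h2, h3, h4⟩ := ((hnear _ s.ρ_lt_one).and
    ((hnear _ hgap).and (hhalf.and self_mem_nhdsWithin))).exists
  exact ⟨ρ, h1, h4, by linarith, h3.le⟩

theorem exists_N_next (s : Block j) {ρ c : ℝ} (hρ : s.ρ < ρ) (hc : 0 < c) :
    ∃ N, s.N ≤ N ∧ 2 * s.ρ ^ (2 * N) ≤ c * ρ ^ (2 * N) := by
  have hρ0 : 0 < ρ := s.ρ_pos.trans hρ
  have hq1 : (s.ρ / ρ) ^ 2 < 1 :=
    pow_lt_one₀ (div_pos s.ρ_pos hρ0).le ((div_lt_one hρ0).2 hρ) two_ne_zero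
  have hlim := tendsto_pow_atTop_nhds_zero_of_lt_one (sq_nonneg (s.ρ / ρ)) hq1
  obtain ⟨N, hN, hle⟩ := ((hlim.eventually (gt_mem_nhds (half_pos hc))).and
    (eventually_ge_atTop s.N)).exists
  rw [← pow_mul, div_pow, div_lt_iff₀ (pow_pos hρ0 _)] at hN
  exact ⟨N, hle, by linarith⟩

theorem exists_n_next (s : Block j) {ρ c : ℝ} (hρ0 : 0 < ρ) (hρ1 : ρ < 1) (hc : 0 < c) (N : ℕ) :
    ∃ n, 2 * s.n ≤ n ∧ ρ ^ n ≤ (1 / 4) ^ (j + 2) ∧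
      (N : ℝ) ≤ (1 / 4) ^ (j + 1) * n * c * ρ ^ (2 * N) := by
  have hpow := (tendsto_pow_atTop_nhds_zero_of_lt_one hρ0.le hρ1).eventually
    (gt_mem_nhds (show (0 : ℝ) < (1 / 4) ^ (j + 2) by positivity))
  have hlin : Tendsto (fun n : ℕ => ((1 / 4) ^ (j + 1) * c * ρ ^ (2 * N)) * (n : ℝ)) atTop atTop :=
    tendsto_natCast_atTop_atTop.const_mul_atTop (by positivity)
  obtain ⟨n, h1, h2, h3⟩ := (hpow.and ((hlin.eventually_ge_atTop (N : ℝ)).and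
    (eventually_ge_atTop (2 * s.n)))).exists
  exact ⟨n, h3, h1.le, h2.trans_eq (by ring)⟩

theorem exists_precedes (s : Block j) : ∃ t : Block (j + 1), s.Precedes t := by
  obtain ⟨ρ, hlt, hρ1, hgap, hhalf⟩ := s.exists_ρ_next
  have hρ0 : 0 < ρ := s.ρ_pos.trans hlt
  let c := min (s.c * s.ρ ^ (2 * (s.N + (j + 1) * s.n)) / 2) ((1 / 2) ^ (j + 1) * (1 - ρ))
  have hc : 0 < c := lt_min
    (half_pos (mul_pos s.c_pos (pow_pos s.ρ_pos _))) (mul_pos (by positivity) (sub_pos.2 hρ1))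
  obtain ⟨N, hsN, htail⟩ := s.exists_N_next hlt hc
  obtain ⟨n, hsn, hpow, hN⟩ := s.exists_n_next hρ0 hρ1 hc N
  have hn : 0 < n := (Nat.mul_pos two_pos s.n_pos).trans_le hsn
  exact ⟨⟨ρ, c, N, n, hρ0, hρ1, hgap, hc, min_le_right _ _, hn, hpow, hN⟩,
    ⟨hlt.le, hhalf, min_le_left _ _, hsN, htail, hsn⟩⟩

end Block

/-- A sequence of compatible blocks. -/
structure BlockSystem where
  block : ∀ j, Block j
  precedes (j : ℕ) : (block j).Precedes (block (j + 1))

namespace BlockSystem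

instance : CoeFun BlockSystem fun _ => ∀ j, Block j := ⟨block⟩

instance : Nonempty BlockSystem := by
  choose next hnext using fun j => Block.exists_precedes (j := j)
  let first : Block 0 :=
    { ρ := 1 / 2, c := 1 / 2, N := 0, n := 2, ρ_pos := by norm_num, ρ_lt_one := by norm_num,
      one_sub_ρ_le := by norm_num, c_pos := by norm_num, c_le := by norm_num,
      n_pos := by norm_num, ρ_pow_n_le := by norm_num, N_le := by norm_num }
  exact ⟨⟨fun j => Nat.rec first next j, fun j => hnext j _⟩⟩

variable (B : BlockSystem)

theorem ρ_mono : Monotone fun j => (B j).ρ := monotone_nat_of_le_succ fun j => (B.precedes j).ρ_le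

theorem N_mono : Monotone fun j => (B j).N := monotone_nat_of_le_succ fun j => (B.precedes j).N_le

theorem c_le_two_pow (j : ℕ) : (B j).c ≤ (1 / 2) ^ j :=
  (B j).c_le.trans (mul_le_of_le_one_right (by positivity) (by linarith [(B j).ρ_pos]))

theorem c_succ_le (j : ℕ) : (B (j + 1)).c ≤ (B j).c / 2 :=
  (B.precedes j).c_le.trans <| div_le_div_of_nonneg_right (mul_le_of_le_one_right (B j).c_pos.le
    (pow_le_one₀ (B j).ρ_pos.le (B j).ρ_lt_one.le)) two_pos.le

theorem c_add_le (j m : ℕ) : (B (j + m)).c ≤ (B j).c * (1 / 2) ^ m := by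
  induction m with
  | zero => simp
  | succ m ih =>
    rw [pow_succ, ← add_assoc]
    linarith [B.c_succ_le (j + m)]

/-- The geometric sequence attached to the `j`-th block. -/
noncomputable def geom (j k : ℕ) : ℝ := (B j).c * (B j).ρ ^ (2 * k)

theorem geom_pos (j k : ℕ) : 0 < B.geom j k := mul_pos (B j).c_pos (pow_pos (B j).ρ_pos _)

theorem geom_le (j k : ℕ) : B.geom j k ≤ (B j).c :=
  mul_le_of_le_one_right (B j).c_pos.le (pow_le_one₀ (B j).ρ_pos.le (B j).ρ_lt_one.le)

theorem geom_add (j k m : ℕ) : B.geom j (k + m) = B.geom j k * (B j).ρ ^ (2 * m) := by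
  rw [geom, geom, mul_add, pow_add, mul_assoc]

theorem summable_geom (k : ℕ) : Summable fun j => B.geom j k :=
  .of_nonneg_of_le (fun j => (B.geom_pos j k).le)
    (fun j => (B.geom_le j k).trans (B.c_le_two_pow j)) summable_geometric_two

/-- The mixture of the geometric sequences of all blocks. -/
noncomputable def mix (k : ℕ) : ℝ := ∑' j, B.geom j k

/-- The contribution to the mixture of the blocks from the `j`-th on. -/
noncomputable def tail (j k : ℕ) : ℝ := ∑' i, B.geom (i + j) k

theorem summable_geom_tail (j k : ℕ) : Summable fun i => B.geom (i + j) k :=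
  (summable_nat_add_iff j).2 (B.summable_geom k)

theorem mix_eq_sum_add_tail (j k : ℕ) : B.mix k = ∑ i ∈ range j, B.geom i k + B.tail j k :=
  ((B.summable_geom k).sum_add_tsum_nat_add j).symm

theorem geom_le_tail (j k : ℕ) : B.geom j k ≤ B.tail j k := by
  simpa only [tail, zero_add] using
    (B.summable_geom_tail j k).le_tsum 0 fun i _ => (B.geom_pos (i + j) k).le

theorem tail_le_mix (j k : ℕ) : B.tail j k ≤ B.mix k := by
  rw [B.mix_eq_sum_add_tail j k]
  exact le_add_of_nonneg_left (sum_nonneg fun i _ => (B.geom_pos i k).le)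

theorem geom_le_mix (j k : ℕ) : B.geom j k ≤ B.mix k :=
  (B.geom_le_tail j k).trans (B.tail_le_mix j k)

theorem mix_pos (k : ℕ) : 0 < B.mix k := (B.geom_pos 0 k).trans_le (B.geom_le_mix 0 k)

theorem mix_zero_le_two : B.mix 0 ≤ 2 :=
  ((B.summable_geom 0).tsum_le_tsum (fun j => (B.geom_le j 0).trans (B.c_le_two_pow j))
    summable_geometric_two).trans_eq tsum_geometric_two

theorem isLogConvexSeq_mix : IsLogConvexSeq B.mix := by
  have hgeom (j k : ℕ) : B.geom j k = (B j).c * ((B j).ρ ^ 2) ^ k := by rw [geom, pow_mul]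
  have hmix : B.mix = fun k => ∑' j, (B j).c * ((B j).ρ ^ 2) ^ k := by
    ext k
    simp only [mix, hgeom]
  rw [hmix]
  refine isLogConvexSeq_tsum (fun j => (B j).c_pos.le) (fun j => sq_nonneg _) (fun k => ?_)
    fun k => ?_
  · simpa only [hgeom] using B.summable_geom k
  · simpa only [mix, hgeom] using B.mix_pos k

theorem sum_range_geom_le (j k : ℕ) (hk : (B j).N ≤ k) :
    ∑ i ∈ range j, B.geom i k ≤ B.geom j k := by
  cases j with
  | zero => simpa using (B.geom_pos 0 k).le
  | succ j =>
    obtain ⟨d, rfl⟩ := Nat.exists_eq_add_of_le hk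
    have hρ := (B j).ρ_pos
    calc ∑ i ∈ range (j + 1), B.geom i ((B (j + 1)).N + d)
        ≤ ∑ i ∈ range (j + 1), (1 / 2 : ℝ) ^ i * (B j).ρ ^ (2 * ((B (j + 1)).N + d)) := by
          refine sum_le_sum fun i hi => ?_
          have := (B i).ρ_pos
          exact mul_le_mul (B.c_le_two_pow i) (pow_le_pow_left₀ this.le
            (B.ρ_mono (Nat.lt_succ_iff.1 (mem_range.1 hi))) _) (by positivity) (by positivity)
      _ ≤ 2 * (B j).ρ ^ (2 * ((B (j + 1)).N + d)) := by
          rw [← sum_mul]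
          exact mul_le_mul_of_nonneg_right ((summable_geometric_two.sum_le_tsum _
            fun i _ => by positivity).trans_eq tsum_geometric_two) (by positivity)
      _ = 2 * (B j).ρ ^ (2 * (B (j + 1)).N) * (B j).ρ ^ (2 * d) := by ring
      _ ≤ B.geom (j + 1) (B (j + 1)).N * (B (j + 1)).ρ ^ (2 * d) :=
          mul_le_mul (B.precedes j).two_mul_ρ_pow_le (pow_le_pow_left₀ hρ.le (B.precedes j).ρ_le _)
            (by positivity) (B.geom_pos _ _).le
      _ = B.geom (j + 1) ((B (j + 1)).N + d) := (B.geom_add _ _ _).symm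

theorem mix_le_two_mul_tail (j k : ℕ) (hk : (B j).N ≤ k) : B.mix k ≤ 2 * B.tail j k := by
  rw [B.mix_eq_sum_add_tail j k]
  linarith [B.sum_range_geom_le j k hk, B.geom_le_tail j k]

theorem pow_mul_tail_le (j k m : ℕ) : (B j).ρ ^ (2 * m) * B.tail j k ≤ B.tail j (k + m) := by
  rw [tail, ← tsum_mul_left]
  refine ((B.summable_geom_tail j k).mul_left _).tsum_le_tsum (fun i => ?_)
    (B.summable_geom_tail j (k + m))
  rw [B.geom_add, mul_comm]
  exact mul_le_mul_of_nonneg_left (pow_le_pow_left₀ (B j).ρ_pos.le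
    (B.ρ_mono (Nat.le_add_left j i)) _) (B.geom_pos _ _).le

theorem pow_mul_mix_le (j k m : ℕ) (hk : (B j).N ≤ k) :
    (B j).ρ ^ (2 * m) * B.mix k ≤ 2 * B.mix (k + m) := by
  have := pow_pos (B j).ρ_pos (2 * m)
  calc (B j).ρ ^ (2 * m) * B.mix k ≤ (B j).ρ ^ (2 * m) * (2 * B.tail j k) := by
        grw [B.mix_le_two_mul_tail j k hk]
    _ = 2 * ((B j).ρ ^ (2 * m) * B.tail j k) := mul_left_comm _ _ _
    _ ≤ 2 * B.mix (k + m) := by grw [B.pow_mul_tail_le, B.tail_le_mix]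

theorem tail_succ_le (j k : ℕ) (hk : k ≤ (B j).N + (j + 1) * (B j).n) :
    B.tail (j + 1) k ≤ B.geom j k := by
  have := (B j).c_pos
  calc B.tail (j + 1) k ≤ ∑' i, (B (j + 1)).c * (1 / 2) ^ i :=
        (B.summable_geom_tail (j + 1) k).tsum_le_tsum
          (fun i => (B.geom_le _ k).trans (add_comm i (j + 1) ▸ B.c_add_le (j + 1) i))
          (summable_geometric_two.mul_left _)
    _ = (B (j + 1)).c * 2 := by rw [tsum_mul_left, tsum_geometric_two]
    _ ≤ (B j).c * (B j).ρ ^ (2 * ((B j).N + (j + 1) * (B j).n)) := by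
        linarith [(B.precedes j).c_le]
    _ ≤ B.geom j k := mul_le_mul_of_nonneg_left
        (pow_le_pow_of_le_one (B j).ρ_pos.le (B j).ρ_lt_one.le (by omega)) this.le

theorem mix_le_three_mul_geom (j k : ℕ) (hk : (B j).N ≤ k)
    (hk' : k ≤ (B j).N + (j + 1) * (B j).n) : B.mix k ≤ 3 * B.geom j k := by
  rw [B.mix_eq_sum_add_tail (j + 1) k, sum_range_succ]
  linarith [B.sum_range_geom_le j k hk, B.tail_succ_le j k hk']

theorem hasSum_geom (j : ℕ) : HasSum (B.geom j) ((B j).c * (1 - (B j).ρ ^ 2)⁻¹) := by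
  unfold geom
  simp_rw [pow_mul]
  exact (hasSum_geometric_of_lt_one (sq_nonneg _)
    (pow_lt_one₀ (B j).ρ_pos.le (B j).ρ_lt_one two_ne_zero)).mul_left _

theorem tsum_geom_le (j : ℕ) : ∑' k, B.geom j k ≤ (1 / 2) ^ j := by
  have h0 := (B j).ρ_pos
  have h1 := (B j).ρ_lt_one
  have hsq : 1 - (B j).ρ ≤ 1 - (B j).ρ ^ 2 := by nlinarith
  rw [(B.hasSum_geom j).tsum_eq, ← div_eq_mul_inv, div_le_iff₀ (by linarith)]
  exact (B j).c_le.trans (by gcongr)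

theorem summable_mix : Summable B.mix := by
  have hprod : Summable fun p : ℕ × ℕ => B.geom p.1 p.2 := by
    rw [summable_prod_of_nonneg fun p => (B.geom_pos p.1 p.2).le]
    exact ⟨fun j => (B.hasSum_geom j).summable, .of_nonneg_of_le
      (fun j => tsum_nonneg fun k => (B.geom_pos j k).le) B.tsum_geom_le summable_geometric_two⟩
  exact hprod.prod_symm.prod

theorem exists_lt_ρ_sq {L : ℝ} (hL : L < 1) : ∃ j, L < (B j).ρ ^ 2 := by
  obtain ⟨j, hj⟩ := exists_pow_lt_of_lt_one (half_pos (sub_pos.2 hL)) one_half_lt_one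
  exact ⟨j, by nlinarith [(B j).one_sub_ρ_le, sq_nonneg (1 - (B j).ρ)]⟩

/-- The coefficient of the `j`-th geometric sequence in the normalized mixture. -/
noncomputable def amp (j : ℕ) : ℝ := (B j).c / B.mix 0

/-- The weight of the space: the mixture, normalized to be `1` at `0`. -/
noncomputable def weight : SummableWeight where
  a k := B.mix k / B.mix 0
  pos k := div_pos (B.mix_pos k) (B.mix_pos 0)
  summable := B.summable_mix.div_const _

theorem weight_zero : B.weight.a 0 = 1 := div_self (B.mix_pos 0).ne'

theorem isLogConvexSeq_weight : IsLogConvexSeq B.weight.a :=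
  B.isLogConvexSeq_mix.div_const (B.mix_pos 0)

theorem amp_pos (j : ℕ) : 0 < B.amp j := div_pos (B j).c_pos (B.mix_pos 0)

theorem weight_le_one (k : ℕ) : B.weight.a k ≤ 1 :=
  div_le_one_of_le₀ ((B.summable_geom k).tsum_le_tsum
    (fun j => (B.geom_le j k).trans_eq (by simp [geom])) (B.summable_geom 0)) (B.mix_pos 0).le

theorem c_le_two_mul_amp (j : ℕ) : (B j).c ≤ 2 * B.amp j := by
  rw [amp, mul_div_assoc', le_div_iff₀ (B.mix_pos 0)]
  nlinarith [B.mix_zero_le_two, (B j).c_pos]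

theorem amp_mul_pow (j k : ℕ) : B.amp j * (B j).ρ ^ (2 * k) = B.geom j k / B.mix 0 :=
  div_mul_eq_mul_div _ _ _

theorem amp_mul_pow_le_weight (j k : ℕ) : B.amp j * (B j).ρ ^ (2 * k) ≤ B.weight.a k :=
  (B.amp_mul_pow j k).trans_le (div_le_div_of_nonneg_right (B.geom_le_mix j k) (B.mix_pos 0).le)

theorem weight_le_three_mul (j k : ℕ) (hk : (B j).N ≤ k)
    (hk' : k ≤ (B j).N + (j + 1) * (B j).n) :
    B.weight.a k ≤ 3 * (B.amp j * (B j).ρ ^ (2 * k)) := by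
  rw [B.amp_mul_pow, mul_div_assoc']
  exact div_le_div_of_nonneg_right (B.mix_le_three_mul_geom j k hk hk') (B.mix_pos 0).le

theorem pow_mul_weight_le (j k m : ℕ) (hk : (B j).N ≤ k) :
    (B j).ρ ^ (2 * m) * B.weight.a k ≤ 2 * B.weight.a (k + m) := by
  simp only [weight]
  rw [mul_div_assoc', mul_div_assoc']
  exact div_le_div_of_nonneg_right (B.pow_mul_mix_le j k m hk) (B.mix_pos 0).le

theorem tendsto_weight_ratio :
    Tendsto (fun k => B.weight.a k / B.weight.a (k + 1)) atTop (𝓝 1) := by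
  refine B.isLogConvexSeq_weight.tendsto_ratio B.weight.summable fun L hL => ?_
  obtain ⟨j, hj⟩ := B.exists_lt_ρ_sq hL
  exact ⟨B.amp j, (B j).ρ ^ 2, B.amp_pos j, hj, fun k => by
    rw [← pow_mul]; exact B.amp_mul_pow_le_weight j k⟩

end BlockSystem

end BlockSystem

section Convolution

open Finset

theorem sum_le_tsum_card_mul {ι α : Type*} {f : α → ℝ} {S : ι → Finset α} {C : ι → ℝ}
    (hC : ∀ i, 0 ≤ C i) (hS : Summable fun i => #(S i) * C i)
    (hf : ∀ x, f x ≠ 0 → ∃ i, x ∈ S i ∧ f x ≤ C i) (T : Finset α) :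
    ∑ x ∈ T, f x ≤ ∑' i, #(S i) * C i := by
  classical
  choose i hmem hle using fun x : {x // f x ≠ 0} => hf x x.2
  let T' : Finset {x // f x ≠ 0} := T.subtype _
  have hfiber (j : ι) : #{x ∈ T' | i x = j} ≤ #(S j) :=
    card_le_card_of_injOn (↑) (fun x hx => by
      rw [← (mem_filter.1 hx).2]
      exact hmem x) Subtype.val_injective.injOn
  calc ∑ x ∈ T, f x = ∑ x ∈ T', f x := by
        rw [← sum_filter_ne_zero, ← subtype_map, sum_map]
        rfl
    _ ≤ ∑ x ∈ T', C (i x) := sum_le_sum fun x _ => hle x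
    _ = ∑ j ∈ T'.image i, #{x ∈ T' | i x = j} * C j := by
        simp only [sum_comp C i, nsmul_eq_mul]
    _ ≤ ∑ j ∈ T'.image i, #(S j) * C j := sum_le_sum fun j _ =>
        mul_le_mul_of_nonneg_right (Nat.cast_le.2 (hfiber j)) (hC j)
    _ ≤ ∑' j, #(S j) * C j :=
        hS.sum_le_tsum _ fun j _ => mul_nonneg (Nat.cast_nonneg _) (hC j)

theorem summable_sum_antidiagonal {F : ℕ × ℕ → ℝ} (hF : Summable F) :
    Summable fun l => ∑ p ∈ antidiagonal l, F p := by
  refine (HasAntidiagonal.sigmaAntidiagonalEquivProd.summable_iff.2 hF).sigma.congr fun l => ?_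
  rw [tsum_fintype]
  exact sum_coe_sort (antidiagonal l) F

variable {P : ℕ → ℕ → ℝ} {x : ℕ → ℝ}

/-- The Schur test for the matrix with entry `P m k` in row `m + k` and column `k`. -/
theorem summable_sq_sum_antidiagonal_of_schur {R : ℝ} (hP : ∀ m k, 0 ≤ P m k)
    (hrow : ∀ l, ∑ p ∈ antidiagonal l, P p.1 p.2 ≤ R)
    (hcol : ∀ k M, ∑ m ∈ range M, P m k ≤ R) (hx : Summable fun k => x k ^ 2) :
    Summable fun l => (∑ p ∈ antidiagonal l, P p.1 p.2 * x p.2) ^ 2 := by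
  have hF : Summable fun p : ℕ × ℕ => P p.2 p.1 * x p.1 ^ 2 := by
    rw [summable_prod_of_nonneg fun p => mul_nonneg (hP _ _) (sq_nonneg _)]
    refine ⟨fun k => (summable_of_sum_range_le (fun m => hP m k) (hcol k)).mul_right (x k ^ 2), ?_⟩
    simp only [tsum_mul_right]
    exact .of_nonneg_of_le (fun k => mul_nonneg (tsum_nonneg fun m => hP m k) (sq_nonneg _))
      (fun k => mul_le_mul_of_nonneg_right
        (Real.tsum_le_of_sum_range_le (fun m => hP m k) (hcol k)) (sq_nonneg _)) (hx.mul_left R)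
  refine .of_nonneg_of_le (fun l => sq_nonneg _) (fun l => ?_)
    ((summable_sum_antidiagonal hF.prod_symm).mul_left R)
  calc (∑ p ∈ antidiagonal l, P p.1 p.2 * x p.2) ^ 2
      ≤ (∑ p ∈ antidiagonal l, P p.1 p.2) * ∑ p ∈ antidiagonal l, P p.1 p.2 * x p.2 ^ 2 :=
        sum_sq_le_sum_mul_sum_of_sq_le_mul _ (fun p _ => hP _ _)
          (fun p _ => mul_nonneg (hP _ _) (sq_nonneg _)) fun p _ => le_of_eq (by ring)
    _ ≤ _ := mul_le_mul_of_nonneg_right (hrow l)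
        (sum_nonneg fun p _ => mul_nonneg (hP _ _) (sq_nonneg _))

theorem summable_sq_sum_antidiagonal_of_summable_sq
    (hP : Summable fun p : ℕ × ℕ => P p.1 p.2 ^ 2) (hx : Summable fun k => x k ^ 2) :
    Summable fun l => (∑ p ∈ antidiagonal l, P p.1 p.2 * x p.2) ^ 2 := by
  refine .of_nonneg_of_le (fun l => sq_nonneg _) (fun l => ?_)
    ((summable_sum_antidiagonal hP).mul_right (∑' k, x k ^ 2))
  refine (sum_mul_sq_le_sq_mul_sq _ _ _).trans
    (mul_le_mul_of_nonneg_left ?_ (sum_nonneg fun p _ => sq_nonneg _))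
  rw [← Nat.sum_antidiagonal_swap]
  simp only [Prod.snd_swap]
  rw [Nat.sum_antidiagonal_eq_sum_range_succ (fun i _ => x i ^ 2)]
  exact hx.sum_le_tsum _ fun k _ => sq_nonneg _

theorem le_of_le_add_convolution {g e f h : ℕ → ℝ} (hg : ∀ n, 0 ≤ g n) (hg0 : g 0 = 0)
    (hf : ∀ n, f n ≤ e n + ∑ p ∈ antidiagonal n, g p.1 * f p.2)
    (hh : ∀ n, e n + ∑ p ∈ antidiagonal n, g p.1 * h p.2 ≤ h n) (n : ℕ) : f n ≤ h n := by
  induction n using Nat.strong_induction_on with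
  | _ n ih =>
    have hsum : ∑ p ∈ antidiagonal n, g p.1 * f p.2 ≤ ∑ p ∈ antidiagonal n, g p.1 * h p.2 := by
      refine sum_le_sum fun p hp => ?_
      rcases Nat.eq_zero_or_pos p.1 with h0 | hpos
      · rw [h0, hg0, zero_mul, zero_mul]
      · have := mem_antidiagonal.1 hp
        exact mul_le_mul_of_nonneg_left (ih _ (by omega)) (hg _)
    linarith [hf n, hh n]

end Convolution

namespace BlockSystem

open Finset PowerSeries

variable (B : BlockSystem)

/-- The support of the `j`-th bump of the test multiplier. -/
def window (j : ℕ) : Finset ℕ := Ico (B j).n (2 * (B j).n)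

theorem card_window (j : ℕ) : #(B.window j) = (B j).n := by
  rw [window, Nat.card_Ico]
  omega

theorem lt_of_mem_window {i j m m' : ℕ} (hij : i < j) (hm : m ∈ B.window i)
    (hm' : m' ∈ B.window j) : m < m' :=
  have hmono : Monotone fun j => (B j).n :=
    monotone_nat_of_le_succ fun j => by have := (B.precedes j).two_mul_n_le; omega
  (mem_Ico.1 hm).2.trans_le
    (((B.precedes i).two_mul_n_le.trans (hmono hij)).trans (mem_Ico.1 hm').1)

theorem eq_of_mem_window {i j m : ℕ} (hi : m ∈ B.window i) (hj : m ∈ B.window j) : i = j :=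
  le_antisymm (not_lt.1 fun h => (B.lt_of_mem_window h hj hi).false)
    (not_lt.1 fun h => (B.lt_of_mem_window h hi hj).false)

/-- The Taylor coefficients of the test multiplier, chosen so that convolution with them averages
`(B j).ρ ^ k` over the `j`-th window. -/
noncomputable def testCoeff (m : ℕ) : ℝ :=
  ∑' j, if m ∈ B.window j then (B j).ρ ^ m / (B j).n else 0

theorem testCoeff_nonneg (m : ℕ) : 0 ≤ B.testCoeff m := tsum_nonneg fun j => by
  have := (B j).ρ_pos
  split_ifs <;> positivity

theorem testCoeff_of_mem {j m : ℕ} (h : m ∈ B.window j) :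
    B.testCoeff m = (B j).ρ ^ m / (B j).n := by
  rw [testCoeff, tsum_eq_single j fun i hi => if_neg fun h' => hi (B.eq_of_mem_window h' h),
    if_pos h]

theorem exists_mem_window_of_testCoeff_ne_zero {m : ℕ} (h : B.testCoeff m ≠ 0) :
    ∃ j, m ∈ B.window j := by
  contrapose! h
  simp [testCoeff, h]

theorem testCoeff_zero : B.testCoeff 0 = 0 := by
  by_contra h
  obtain ⟨j, hj⟩ := B.exists_mem_window_of_testCoeff_ne_zero h
  have := (B j).n_pos
  have := (mem_Ico.1 hj).1
  omega

theorem sum_testCoeff_le (S : Finset ℕ) : ∑ m ∈ S, B.testCoeff m ≤ 1 / 3 := by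
  have hn (j : ℕ) : (0 : ℝ) < (B j).n := Nat.cast_pos.2 (B j).n_pos
  have hgeom : HasSum (fun j => #(B.window j) * ((1 / 4 : ℝ) ^ (j + 1) / (B j).n)) (1 / 3) := by
    simp_rw [card_window, mul_div_cancel₀ _ (hn _).ne', pow_succ]
    convert! (hasSum_geometric_of_lt_one (r := (1 / 4 : ℝ)) (by norm_num)
      (by norm_num)).mul_right (1 / 4) using 1
    norm_num
  refine (sum_le_tsum_card_mul (fun j => by positivity) hgeom.summable (fun m hm => ?_) S).trans_eq
    hgeom.tsum_eq
  obtain ⟨j, hj⟩ := B.exists_mem_window_of_testCoeff_ne_zero hm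
  refine ⟨j, hj, ?_⟩
  rw [B.testCoeff_of_mem hj]
  exact div_le_div_of_nonneg_right ((pow_le_pow_of_le_one (B j).ρ_pos.le (B j).ρ_lt_one.le
    (mem_Ico.1 hj).1).trans (B j).ρ_pow_n_le) (hn j).le

theorem summable_testCoeff : Summable B.testCoeff :=
  summable_of_sum_le B.testCoeff_nonneg B.sum_testCoeff_le

theorem tsum_testCoeff_le : ∑' m, B.testCoeff m ≤ 1 / 3 :=
  Real.tsum_le_of_sum_le B.testCoeff_nonneg B.sum_testCoeff_le

/-- The entry in row `m + k` and column `k` of the matrix of multiplication by the test multiplier,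
with respect to the orthonormal basis of normalized monomials. -/
noncomputable def entry (m k : ℕ) : ℝ :=
  B.testCoeff m * √(B.weight.a k / B.weight.a (m + k))

theorem entry_nonneg (m k : ℕ) : 0 ≤ B.entry m k :=
  mul_nonneg (B.testCoeff_nonneg m) (Real.sqrt_nonneg _)

theorem entry_sq (m k : ℕ) :
    B.entry m k ^ 2 = B.testCoeff m ^ 2 * (B.weight.a k / B.weight.a (m + k)) := by
  rw [entry, mul_pow, Real.sq_sqrt (div_nonneg (B.weight.pos _).le (B.weight.pos _).le)]

theorem exists_mem_window_of_entry_ne_zero {m k : ℕ} (h : B.entry m k ≠ 0) :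
    ∃ j, m ∈ B.window j :=
  B.exists_mem_window_of_testCoeff_ne_zero (left_ne_zero_of_mul h)

theorem entry_sq_le_of_lt {j m k : ℕ} (hm : m ∈ B.window j) (hk : k < (B j).N) :
    B.entry m k ^ 2 ≤ 1 / ((B j).n ^ 2 * B.amp j * (B j).ρ ^ (2 * (B j).N)) := by
  have hρ := (B j).ρ_pos
  have hn : (0 : ℝ) < (B j).n := Nat.cast_pos.2 (B j).n_pos
  have hc := B.amp_pos j
  have hratio : B.weight.a k / B.weight.a (m + k) ≤ 1 / (B.amp j * (B j).ρ ^ (2 * (m + k))) :=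
    div_le_div₀ zero_le_one (B.weight_le_one k) (by positivity) (B.amp_mul_pow_le_weight j (m + k))
  have hpow : (B j).ρ ^ (2 * (B j).N) ≤ (B j).ρ ^ (2 * k) :=
    pow_le_pow_of_le_one hρ.le (B j).ρ_lt_one.le (by omega)
  rw [entry_sq, B.testCoeff_of_mem hm]
  calc ((B j).ρ ^ m / (B j).n) ^ 2 * (B.weight.a k / B.weight.a (m + k))
      ≤ ((B j).ρ ^ m / (B j).n) ^ 2 * (1 / (B.amp j * (B j).ρ ^ (2 * (m + k)))) := by gcongr
    _ = 1 / ((B j).n ^ 2 * B.amp j * (B j).ρ ^ (2 * k)) := by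
        rw [show 2 * (m + k) = m * 2 + 2 * k by ring, pow_add, pow_mul]
        field_simp
    _ ≤ _ := by gcongr

theorem entry_le_two_div {j m k : ℕ} (hm : m ∈ B.window j) (hk : (B j).N ≤ k) :
    B.entry m k ≤ 2 / (B j).n := by
  have hn : (0 : ℝ) < (B j).n := Nat.cast_pos.2 (B j).n_pos
  have hratio : (B j).ρ ^ (2 * m) * (B.weight.a k / B.weight.a (m + k)) ≤ 2 ^ 2 := by
    rw [mul_div_assoc', div_le_iff₀ (B.weight.pos _), add_comm m k]
    linarith [B.pow_mul_weight_le j k m hk, B.weight.pos (k + m)]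
  refine (sq_le_sq₀ (B.entry_nonneg _ _) (by positivity)).1 ?_
  rw [entry_sq, B.testCoeff_of_mem hm, div_pow, div_pow, div_mul_eq_mul_div, ← pow_mul, mul_comm m]
  gcongr

theorem entry_le_two_mul_testCoeff {j m k : ℕ} (hm : m ∈ B.window j) (hk : (B (j + 1)).N ≤ k) :
    B.entry m k ≤ 2 * B.testCoeff m := by
  have hhalf : 1 / 2 ≤ (B (j + 1)).ρ ^ (2 * m) :=
    (B.precedes j).half_le_ρ_pow.trans <| pow_le_pow_of_le_one (B _).ρ_pos.le (B _).ρ_lt_one.le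
      (by have := (mem_Ico.1 hm).2; omega)
  have hratio : B.weight.a k / B.weight.a (m + k) ≤ 2 ^ 2 := by
    rw [div_le_iff₀ (B.weight.pos _), add_comm m k]
    nlinarith [B.weight.pos k, B.pow_mul_weight_le (j + 1) k m hk]
  rw [entry, mul_comm]
  exact mul_le_mul_of_nonneg_right (Real.sqrt_le_iff.2 ⟨two_pos.le, hratio⟩) (B.testCoeff_nonneg m)

open Classical in
/-- The entries in columns before the block that carries the window of `m`. -/
noncomputable def lowEntry (m k : ℕ) : ℝ :=
  if ∃ j, m ∈ B.window j ∧ k < (B j).N then B.entry m k else 0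

open Classical in
/-- The entries in columns between the block that carries the window of `m` and the next one. -/
noncomputable def midEntry (m k : ℕ) : ℝ :=
  if ∃ j, m ∈ B.window j ∧ k ∈ Ico (B j).N (B (j + 1)).N then B.entry m k else 0

theorem lowEntry_nonneg (m k : ℕ) : 0 ≤ B.lowEntry m k := by
  rw [lowEntry]
  split_ifs
  exacts [B.entry_nonneg m k, le_rfl]

theorem midEntry_nonneg (m k : ℕ) : 0 ≤ B.midEntry m k := by
  rw [midEntry]
  split_ifs
  exacts [B.entry_nonneg m k, le_rfl]

theorem entry_le_lowEntry_add (m k : ℕ) :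
    B.entry m k ≤ B.lowEntry m k + (2 * B.testCoeff m + B.midEntry m k) := by
  have hg := B.testCoeff_nonneg m
  have hl := B.lowEntry_nonneg m k
  have hm := B.midEntry_nonneg m k
  by_cases h0 : B.entry m k = 0
  · linarith
  obtain ⟨j, hj⟩ := B.exists_mem_window_of_entry_ne_zero h0
  rcases lt_or_ge k (B j).N with hlow | hlow
  · have : B.lowEntry m k = B.entry m k := if_pos ⟨j, hj, hlow⟩
    linarith
  rcases lt_or_ge k (B (j + 1)).N with hmid | hmid
  · have : B.midEntry m k = B.entry m k := if_pos ⟨j, hj, mem_Ico.2 ⟨hlow, hmid⟩⟩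
    linarith
  · linarith [B.entry_le_two_mul_testCoeff hj hmid]

theorem card_mul_entry_bound_le (j : ℕ) :
    #(B.window j ×ˢ range (B j).N) * (1 / ((B j).n ^ 2 * B.amp j * (B j).ρ ^ (2 * (B j).N))) ≤
      2 * (1 / 4) ^ j := by
  have hn : (0 : ℝ) < (B j).n := Nat.cast_pos.2 (B j).n_pos
  have hρ := (B j).ρ_pos
  have hc := B.amp_pos j
  rw [card_product, card_window, card_range, Nat.cast_mul, mul_one_div, div_le_iff₀ (by positivity)]
  calc ((B j).n : ℝ) * (B j).N
      ≤ (B j).n * ((1 / 4) ^ j * (B j).n * (2 * B.amp j) * (B j).ρ ^ (2 * (B j).N)) := by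
        grw [(B j).N_le, B.c_le_two_mul_amp j]
    _ = _ := by ring

theorem summable_lowEntry_sq : Summable fun p : ℕ × ℕ => B.lowEntry p.1 p.2 ^ 2 := by
  have hC (j : ℕ) : 0 ≤ 1 / ((B j).n ^ 2 * B.amp j * (B j).ρ ^ (2 * (B j).N)) := by
    have := B.amp_pos j
    have := (B j).ρ_pos
    positivity
  refine summable_of_sum_le (fun p => sq_nonneg _) <| sum_le_tsum_card_mul
    (S := fun j => B.window j ×ˢ range (B j).N) hC
    (.of_nonneg_of_le (fun j => mul_nonneg (Nat.cast_nonneg _) (hC j)) B.card_mul_entry_bound_le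
      ((summable_geometric_of_lt_one (by norm_num) (by norm_num)).mul_left 2)) fun p hp => ?_
  have hp' := pow_ne_zero_iff two_ne_zero |>.1 hp
  rw [lowEntry] at hp' ⊢
  split_ifs at hp' ⊢ with h
  · obtain ⟨j, hm, hk⟩ := h
    exact ⟨j, mem_product.2 ⟨hm, mem_range.2 hk⟩, B.entry_sq_le_of_lt hm hk⟩
  · exact absurd rfl hp'

theorem exists_of_midEntry_ne_zero {m k : ℕ} (h : B.midEntry m k ≠ 0) :
    ∃ j, m ∈ B.window j ∧ k ∈ Ico (B j).N (B (j + 1)).N ∧ B.midEntry m k ≤ 2 / (B j).n := by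
  rw [midEntry] at h ⊢
  split_ifs at h ⊢ with hmid
  · obtain ⟨j, hm, hk⟩ := hmid
    exact ⟨j, hm, hk, B.entry_le_two_div hm (mem_Ico.1 hk).1⟩
  · exact absurd rfl h

/-- Windows and blocks are ordered in the same way, so a decreasing path meets at most one of the
rectangles that support the middle entries. -/
theorem sum_midEntry_le {κ : ℕ → ℕ} (hκ : Antitone κ) (S : Finset ℕ) :
    ∑ m ∈ S, B.midEntry m (κ m) ≤ 2 := by
  by_cases h : ∀ m ∈ S, B.midEntry m (κ m) = 0
  · rw [sum_eq_zero h]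
    exact two_pos.le
  push Not at h
  obtain ⟨m₀, -, hm₀⟩ := h
  obtain ⟨j, hj, hκj, -⟩ := B.exists_of_midEntry_ne_zero hm₀
  have hlt {i i' m m' : ℕ} (hii : i < i') (hm : m ∈ B.window i) (hm' : m' ∈ B.window i')
      (hk : κ m ∈ Ico (B i).N (B (i + 1)).N) (hk' : κ m' ∈ Ico (B i').N (B (i' + 1)).N) : False :=
    ((mem_Ico.1 hk).2.trans_le ((B.N_mono hii).trans (mem_Ico.1 hk').1)).not_ge
      (hκ (B.lt_of_mem_window hii hm hm').le)
  have hn : (0 : ℝ) < (B j).n := Nat.cast_pos.2 (B j).n_pos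
  refine (sum_le_tsum_card_mul (ι := Unit) (S := fun _ => B.window j) (C := fun _ => 2 / (B j).n)
    (fun _ => by positivity) .of_finite (fun m hm => ⟨(), ?_⟩) S).trans_eq ?_
  · obtain ⟨i, hi, hκi, hle⟩ := B.exists_of_midEntry_ne_zero hm
    obtain rfl : i = j := le_antisymm (not_lt.1 fun h => hlt h hj hi hκj hκi)
      (not_lt.1 fun h => hlt h hi hj hκi hκj)
    exact ⟨hi, hle⟩
  · rw [tsum_fintype, Fintype.sum_unique, card_window, mul_div_cancel₀ _ hn.ne']

theorem sum_testCoeff_add_midEntry_le {κ : ℕ → ℕ} (hκ : Antitone κ) (S : Finset ℕ) :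
    ∑ m ∈ S, (2 * B.testCoeff m + B.midEntry m (κ m)) ≤ 3 := by
  rw [sum_add_distrib, ← mul_sum]
  linarith [B.sum_testCoeff_le S, B.sum_midEntry_le hκ S]

theorem summable_sq_sum_entry {x : ℕ → ℝ} (hx0 : ∀ k, 0 ≤ x k) (hx : Summable fun k => x k ^ 2) :
    Summable fun l => (∑ p ∈ antidiagonal l, B.entry p.1 p.2 * x p.2) ^ 2 := by
  let P (m k : ℕ) : ℝ := 2 * B.testCoeff m + B.midEntry m k
  have hrow (l : ℕ) : ∑ p ∈ antidiagonal l, P p.1 p.2 ≤ 3 := by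
    rw [Nat.sum_antidiagonal_eq_sum_range_succ P]
    exact B.sum_testCoeff_add_midEntry_le (fun _ _ h => Nat.sub_le_sub_left h l) _
  have hlow := summable_sq_sum_antidiagonal_of_summable_sq B.summable_lowEntry_sq hx
  have hrest := summable_sq_sum_antidiagonal_of_schur (P := P)
    (fun m k => add_nonneg (mul_nonneg two_pos.le (B.testCoeff_nonneg m)) (B.midEntry_nonneg m k))
    hrow (fun k M => B.sum_testCoeff_add_midEntry_le antitone_const _) hx
  refine .of_nonneg_of_le (fun l => sq_nonneg _) (fun l => ?_) ((hlow.add hrest).mul_left 2)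
  refine (pow_le_pow_left₀ (sum_nonneg fun p _ => mul_nonneg (B.entry_nonneg _ _) (hx0 _))
    ?_ 2).trans add_sq_le
  rw [← sum_add_distrib]
  refine sum_le_sum fun p _ => ?_
  rw [← add_mul]
  exact mul_le_mul_of_nonneg_right (B.entry_le_lowEntry_add _ _) (hx0 _)

/-- The Taylor series of the test multiplier. -/
noncomputable def testSeries : ℂ⟦X⟧ := PowerSeries.mk fun n => (B.testCoeff n : ℂ)

theorem absSummable_testSeries : AbsSummable B.testSeries :=
  WeightedHardy.absSummable_mk_ofReal B.testCoeff_nonneg B.summable_testCoeff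

theorem norm_coeff_testSeries (n : ℕ) : ‖coeff n B.testSeries‖ = B.testCoeff n := by
  rw [testSeries, coeff_mk, Complex.norm_real, Real.norm_of_nonneg (B.testCoeff_nonneg n)]

theorem norm_coeff_testSeries_mul_div_sqrt_le (u : ℂ⟦X⟧) (n : ℕ) :
    ‖coeff n (B.testSeries * u)‖ / √(B.weight.a n) ≤
      ∑ p ∈ antidiagonal n, B.entry p.1 p.2 * (‖coeff p.2 u‖ / √(B.weight.a p.2)) := by
  rw [coeff_mul]
  refine (div_le_div_of_nonneg_right (norm_sum_le _ _) (Real.sqrt_nonneg _)).trans_eq ?_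
  rw [sum_div]
  refine sum_congr rfl fun p hp => ?_
  have hpos : 0 < √(B.weight.a p.2) := Real.sqrt_pos.2 (B.weight.pos _)
  rw [norm_mul, norm_coeff_testSeries, entry, mem_antidiagonal.1 hp,
    Real.sqrt_div (B.weight.pos _).le]
  field_simp

theorem exists_mult_eq_evalDisc_testSeries :
    ∃ φ : Mult (WeightedHardy B.weight), ∀ z : ClosedDisc, φ z = evalDisc B.testSeries z := by
  have hsq (u : ℂ⟦X⟧) (n : ℕ) :
      (‖coeff n u‖ / √(B.weight.a n)) ^ 2 = ‖coeff n u‖ ^ 2 / B.weight.a n := by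
    rw [div_pow, Real.sq_sqrt (B.weight.pos n).le]
  refine WeightedHardy.exists_mult_eq_evalDisc fun f => ?_
  have hx := f.hasSum_norm_coeff_sq_div.summable
  simp_rw [← hsq] at hx ⊢
  have hsum := B.summable_sq_sum_entry (fun k => div_nonneg (norm_nonneg _) (Real.sqrt_nonneg _)) hx
  exact hsum.of_nonneg_of_le (fun n => sq_nonneg _) fun n => pow_le_pow_left₀
    (div_nonneg (norm_nonneg _) (Real.sqrt_nonneg _))
    (B.norm_coeff_testSeries_mul_div_sqrt_le f.series n) 2

/-- The powers of `(B j).ρ`, cut off to the first `L * (B j).n` indices of the `j`-th block. -/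
noncomputable def blockPow (j L k : ℕ) : ℝ :=
  if k ∈ Ico (B j).N ((B j).N + L * (B j).n) then (B j).ρ ^ k else 0

theorem blockPow_nonneg (j L k : ℕ) : 0 ≤ B.blockPow j L k := by
  have := (B j).ρ_pos
  rw [blockPow]
  split_ifs <;> positivity

theorem card_Ico_block (j L : ℕ) :
    (#(Ico (B j).N ((B j).N + L * (B j).n)) : ℝ) = L * (B j).n := by
  rw [Nat.card_Ico, Nat.add_sub_cancel_left, Nat.cast_mul]

theorem sum_window_testCoeff_mul_blockPow {j L l : ℕ} (hl : (B j).N + 2 * (B j).n ≤ l)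
    (hlL : l < (B j).N + L * (B j).n) :
    ∑ m ∈ B.window j, B.testCoeff m * B.blockPow j L (l - m) = B.blockPow j L l := by
  have hn : (0 : ℝ) < (B j).n := Nat.cast_pos.2 (B j).n_pos
  have hterm : ∀ m ∈ B.window j,
      B.testCoeff m * B.blockPow j L (l - m) = (B j).ρ ^ l / (B j).n := fun m hm => by
    have hm' := mem_Ico.1 hm
    rw [B.testCoeff_of_mem hm, blockPow, if_pos (mem_Ico.2 (by omega)), div_mul_eq_mul_div,
      ← pow_add, Nat.add_sub_cancel' (by omega)]
  rw [sum_congr rfl hterm, sum_const, card_window, nsmul_eq_mul, mul_div_cancel₀ _ hn.ne',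
    blockPow, if_pos (mem_Ico.2 (by omega))]

theorem blockPow_le_add_convolution (j L l : ℕ) :
    B.blockPow j L l ≤
      B.blockPow j 2 l + ∑ p ∈ antidiagonal l, B.testCoeff p.1 * B.blockPow j L p.2 := by
  have hnonneg (m k : ℕ) : 0 ≤ B.testCoeff m * B.blockPow j L k :=
    mul_nonneg (B.testCoeff_nonneg m) (B.blockPow_nonneg j L k)
  by_cases hl : l ∈ Ico (B j).N ((B j).N + L * (B j).n)
  · by_cases hl2 : l ∈ Ico (B j).N ((B j).N + 2 * (B j).n)
    · have heq : B.blockPow j 2 l = B.blockPow j L l := by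
        rw [blockPow, blockPow, if_pos hl, if_pos hl2]
      rw [heq]
      exact le_add_of_nonneg_right (sum_nonneg fun p _ => hnonneg _ _)
    · rw [mem_Ico] at hl hl2
      have hsub : B.window j ⊆ range l.succ := fun m hm => by
        have := mem_Ico.1 hm
        exact mem_range.2 (by omega)
      rw [Nat.sum_antidiagonal_eq_sum_range_succ (fun m k => B.testCoeff m * B.blockPow j L k),
        ← B.sum_window_testCoeff_mul_blockPow (by omega) hl.2]
      exact (sum_le_sum_of_subset_of_nonneg hsub fun m _ _ => hnonneg _ _).trans
        (le_add_of_nonneg_left (B.blockPow_nonneg _ _ _))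
  · rw [blockPow, if_neg hl]
    exact add_nonneg (B.blockPow_nonneg _ _ _) (sum_nonneg fun p _ => hnonneg _ _)

theorem exists_series_eq_blockPow (j L : ℕ) :
    ∃ E : WeightedHardy B.weight, E.series = PowerSeries.mk (fun k => (B.blockPow j L k : ℂ)) ∧
      ‖E‖ ^ 2 ≤ L * (B j).n / B.amp j := by
  have hterm (k : ℕ) (hk : k ∉ Ico (B j).N ((B j).N + L * (B j).n)) :
      ‖coeff k (PowerSeries.mk fun k => (B.blockPow j L k : ℂ))‖ ^ 2 / B.weight.a k = 0 := by
    rw [coeff_mk, blockPow, if_neg hk]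
    simp
  obtain ⟨E, hE⟩ := WeightedHardy.exists_series_eq (summable_of_ne_finset_zero hterm)
  refine ⟨E, hE, ?_⟩
  have hnorm := E.hasSum_norm_coeff_sq_div
  simp only [hE] at hnorm
  rw [hnorm.unique (hasSum_sum_of_ne_finset_zero hterm), ← card_Ico_block, div_eq_mul_one_div,
    ← nsmul_eq_mul]
  refine sum_le_card_nsmul _ _ _ fun k hk => ?_
  rw [coeff_mk, Complex.norm_real, Real.norm_eq_abs, sq_abs, blockPow, if_pos hk,
    div_le_div_iff₀ (B.weight.pos k) (B.amp_pos j), one_mul, ← pow_mul, mul_comm k 2, mul_comm]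
  exact B.amp_mul_pow_le_weight j k

theorem le_norm_sq_of_blockPow_le (j : ℕ) {F : WeightedHardy B.weight}
    (hF : ∀ k, B.blockPow j (j + 1) k ≤ (coeff k F.series).re) :
    ((j + 1 : ℕ) : ℝ) * (B j).n / (3 * B.amp j) ≤ ‖F‖ ^ 2 := by
  have hamp := B.amp_pos j
  refine le_trans ?_ (sum_le_hasSum (Ico (B j).N ((B j).N + (j + 1) * (B j).n))
    (fun k _ => div_nonneg (sq_nonneg _) (B.weight.pos k).le) F.hasSum_norm_coeff_sq_div)
  rw [← card_Ico_block, div_eq_mul_one_div, ← nsmul_eq_mul]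
  refine card_nsmul_le_sum _ _ _ fun k hk => ?_
  have hcoeff : (B j).ρ ^ k ≤ ‖coeff k F.series‖ := by
    have hle := (hF k).trans (Complex.re_le_norm _)
    rwa [blockPow, if_pos hk] at hle
  obtain ⟨hk1, hk2⟩ := mem_Ico.1 hk
  rw [div_le_div_iff₀ (by positivity) (B.weight.pos k), one_mul]
  calc B.weight.a k ≤ 3 * (B.amp j * (B j).ρ ^ (2 * k)) := B.weight_le_three_mul j k hk1 hk2.le
    _ = ((B j).ρ ^ k) ^ 2 * (3 * B.amp j) := by rw [← pow_mul, mul_comm k 2]; ring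
    _ ≤ ‖coeff k F.series‖ ^ 2 * (3 * B.amp j) := by
        have := (B j).ρ_pos
        gcongr

theorem blockPow_le_of_series_eq {j : ℕ} {E F : WeightedHardy B.weight}
    (hE : E.series = PowerSeries.mk fun k => (B.blockPow j 2 k : ℂ))
    (hF : E.series = (1 - B.testSeries) * F.series) (k : ℕ) :
    B.blockPow j (j + 1) k ≤ (coeff k F.series).re := by
  refine le_of_le_add_convolution B.testCoeff_nonneg B.testCoeff_zero
    (B.blockPow_le_add_convolution j (j + 1)) (h := fun k => (coeff k F.series).re)
    (fun k => le_of_eq ?_) k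
  have hsplit : F.series = E.series + B.testSeries * F.series := by
    rw [hF]
    ring
  conv_rhs =>
    rw [hsplit, hE, map_add, coeff_mk, coeff_mul, Complex.add_re, Complex.ofReal_re, Complex.re_sum]
  simp only [testSeries, coeff_mk, Complex.re_ofReal_mul]

/-- The test multiplier. -/
noncomputable def testMult : Mult (WeightedHardy B.weight) :=
  B.exists_mult_eq_evalDisc_testSeries.choose

theorem one_sub_testMult_apply (z : ClosedDisc) :
    (1 - B.testMult : Mult (WeightedHardy B.weight)) z = evalDisc (1 - B.testSeries) z := by
  rw [absSummable_one.evalDisc_sub B.absSummable_testSeries z.norm_le_one, evalDisc_one,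
    ← B.exists_mult_eq_evalDisc_testSeries.choose_spec z]
  rfl

theorem le_norm_one_sub_testMult_apply (z : ClosedDisc) :
    2 / 3 ≤ ‖(1 - B.testMult : Mult (WeightedHardy B.weight)) z‖ := by
  have hle : ‖evalDisc B.testSeries z‖ ≤ 1 / 3 := by
    refine (B.absSummable_testSeries.norm_evalDisc_le z.norm_le_one).trans ?_
    simpa only [norm_coeff_testSeries] using B.tsum_testCoeff_le
  rw [one_sub_testMult_apply, absSummable_one.evalDisc_sub B.absSummable_testSeries z.norm_le_one,
    evalDisc_one]
  have htri := norm_sub_norm_le 1 (evalDisc B.testSeries z)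
  rw [norm_one] at htri
  linarith

theorem one_sub_testMult_apply_ne_zero (z : ClosedDisc) :
    (1 - B.testMult : Mult (WeightedHardy B.weight)) z ≠ 0 :=
  norm_pos_iff.1 (lt_of_lt_of_le (by norm_num) (B.le_norm_one_sub_testMult_apply z))

theorem add_one_le_six_mul_norm_sq {ψ : Mult (WeightedHardy B.weight)}
    (hψ : (1 - B.testMult) * ψ = 1) (j : ℕ) : ((j + 1 : ℕ) : ℝ) ≤ 6 * ‖ψ‖ ^ 2 := by
  have hn : (0 : ℝ) < (B j).n := Nat.cast_pos.2 (B j).n_pos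
  have hamp := B.amp_pos j
  obtain ⟨E, hE, hEnorm⟩ := B.exists_series_eq_blockPow j 2
  have hseries : E.series = (1 - B.testSeries) * (ψ.mulOp E).series := by
    refine (WeightedHardy.forall_apply_eq_mul_iff
      (absSummable_one.sub B.absSummable_testSeries) E (ψ.mulOp E)).1 fun z => ?_
    have hz : (1 - B.testMult : Mult (WeightedHardy B.weight)) z * ψ z = 1 := congrArg (· z) hψ
    rw [← one_sub_testMult_apply, Mult.mulOp_apply, ← mul_assoc, hz, one_mul]
  have hop : ‖ψ.mulOp E‖ ≤ ‖ψ‖ * ‖E‖ := ψ.mulOp.le_opNorm E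
  have hchain : ((j + 1 : ℕ) : ℝ) * (B j).n / (3 * B.amp j) ≤ ‖ψ‖ ^ 2 * (2 * (B j).n / B.amp j) :=
    calc _ ≤ ‖ψ.mulOp E‖ ^ 2 :=
          B.le_norm_sq_of_blockPow_le j (B.blockPow_le_of_series_eq hE hseries)
      _ ≤ (‖ψ‖ * ‖E‖) ^ 2 := by gcongr
      _ = ‖ψ‖ ^ 2 * ‖E‖ ^ 2 := mul_pow _ _ _
      _ ≤ _ := by gcongr; exact_mod_cast hEnorm
  refine le_of_mul_le_mul_right ?_ hn
  calc _ ≤ ‖ψ‖ ^ 2 * (2 * (B j).n / B.amp j) * (3 * B.amp j) :=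
        (div_le_iff₀ (by positivity)).1 hchain
    _ = 6 * ‖ψ‖ ^ 2 * (B j).n := by
        field_simp
        ring

theorem not_isUnit_one_sub_testMult : ¬IsUnit (1 - B.testMult) := fun h => by
  obtain ⟨ψ, hψ⟩ := h.exists_right_inv
  obtain ⟨j, hj⟩ := exists_nat_gt (6 * ‖ψ‖ ^ 2)
  exact absurd (hj.trans (Nat.cast_lt.2 j.lt_succ_self)) (B.add_one_le_six_mul_norm_sq hψ j).not_gt

theorem not_oneFunctionCorona : ¬OneFunctionCorona (WeightedHardy B.weight) := fun h => by
  obtain ⟨ψ, hψ⟩ := h (1 - B.testMult) (lt_of_lt_of_le (by norm_num)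
    (le_ciInf B.le_norm_one_sub_testMult_apply))
  refine B.not_isUnit_one_sub_testMult (.of_mul_eq_one ψ (Subtype.ext (funext fun z => ?_)))
  change (1 - B.testMult : Mult (WeightedHardy B.weight)) z * ψ z = 1
  rw [hψ, mul_one_div_cancel (B.one_sub_testMult_apply_ne_zero z)]

end BlockSystem

theorem theorem1p6 :
    ∃ (H : Type) (_ : NormedAddCommGroup H) (_ : InnerProductSpace ℂ H) (_ : CompleteSpace H)
      (_ : RKHS ℂ H ClosedDisc ℂ) (a : ℕ → ℝ),
      a 0 = 1 ∧ (∀ n, 0 < a n) ∧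
      Filter.Tendsto (fun n => a n / a (n + 1)) Filter.atTop (nhds 1) ∧
      Summable a ∧
      (∀ z w : ClosedDisc, HasSum (fun n => (a n : ℂ) * ((z : ℂ) * star (w : ℂ)) ^ n)
        (scalarKernel H z w)) ∧
      IsCompletePick H ∧
      IsMaximalDomain H ∧
      ¬ OneFunctionCorona H ∧
      ∃ ev : ClosedDisc → MaximalIdealSpace H,
        (∀ (z : ClosedDisc) (φ : Mult H), ev z φ = φ z) ∧
        Topology.IsEmbedding ev ∧ IsCompact (Set.range ev) ∧ Set.range ev ≠ Set.univ := by
  obtain ⟨B⟩ := (inferInstance : Nonempty BlockSystem)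
  obtain ⟨φ, hφ⟩ := WeightedHardy.exists_mult_eq_coe B.tendsto_weight_ratio
  have hemb := WeightedHardy.isEmbedding_evalCharacter hφ
  refine ⟨WeightedHardy B.weight, inferInstance, inferInstance, inferInstance, inferInstance,
    B.weight.a, B.weight_zero, B.weight.pos, B.tendsto_weight_ratio, B.weight.summable,
    WeightedHardy.hasSum_scalarKernel,
    WeightedHardy.isCompletePick B.isLogConvexSeq_weight B.weight_zero,
    WeightedHardy.isMaximalDomain B.tendsto_weight_ratio, B.not_oneFunctionCorona,
    Mult.evalCharacter WeightedHardy.exists_apply_ne_zero, Mult.evalCharacter_apply _, hemb,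
    isCompact_range hemb.continuous, fun huniv => ?_⟩
  obtain ⟨χ, hχ⟩ := Mult.exists_character_eq_zero WeightedHardy.exists_apply_ne_zero
    B.not_isUnit_one_sub_testMult
  obtain ⟨z, rfl⟩ : χ ∈ Set.range _ := huniv ▸ Set.mem_univ χ
  exact B.one_sub_testMult_apply_ne_zero z hχ
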